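/- Let $p$ be an odd prime, $k=\mathbb F_p^a$ the algebraic closure of $\mathbb F_p$, $R=W(k)$ the ring of $p$-typical Witt vectors of $k$, $K$ its fraction field, $\phi:R\to R$ the unique ring endomorphism lifting the $p$-power Frobenius of $k$, and $\delta a=\frac{\phi(a)-a^p}{p}$ for $a\in R$. For a matrix $u=(u_{ij})$ write $u^{(p)}=(u_{ij}^p)$ and, if $u$ has entries in $R$, $\delta u=(\delta u_{ij})$. For $x$ an $n\times n$ matrix of indeterminates and a ring $S$, let $S[x,\det(x)^{-1}]\hat{\ }$ be the $p$-adic completion of $S[x,\det(x)^{-1}]$. Let $\Delta(x)$ be any $n\times n$ matrix with entries in $R[x,\det(x)^{-1}]\hat{\ }$, and for $\alpha\in\mathfrak{gl}_n(R)$ put $$\Phi(x)=x^{(p)}+p\Delta(x),\qquad \Delta^\alpha(x)=\alpha\cdot\Phi(x)+\Delta(x).$$ $\Delta$ is of type $GL_n$ if $\Delta=0$. It is of type $SL_n$ if $p\nmid n$ and $\Delta(x)=\frac{\lambda(x)-1}{p}\,x^{(p)}$ with $\lambda(x)=\left(\det(x^{(p)})/\det(x)^p\right)^{-1/n}$. For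 $q$ one of the matrices $$\begin{pmatrix}0&1_r\\-1_r&0\end{pmatrix},\quad \begin{pmatrix}0&1_r\\1_r&0\end{pmatrix},\quad \begin{pmatrix}1&0&0\\0&0&1_r\\0&1_r&0\end{pmatrix}$$ (with $n=2r,2r,2r+1$ respectively), $\Delta$ is of type $SO(q)$ if $\Delta(x)=x^{(p)}\cdot\frac1p(\Lambda(x)-1)$ with $\Lambda(x)=\left(((x^{(p)})^tqx^{(p)})^{-1}(x^tqx)^{(p)}\right)^{1/2}$. Powers with exponent $a\in\mathbb Z_p$ are given by the binomial series $(1+pt)^a=\sum_k\binom ak p^kt^k$. Let $SL_n=\{u\in GL_n(R):\det u=1\}$ and $SO(q)=\{u\in SL_n: u^tqu=q\}$, and let $\mathfrak{sl}_{n,\delta}$ (resp. $\mathfrak{so}(q)_\delta$) be the set of $\alpha\in\mathfrak{gl}_n(R)$ with $1+p\alpha\in SL_n$ (resp. $1+p\alpha\in SO(q)$). A valuation subring of $R$ is a subring of the form $R\cap F$ with $F$ a subfield of $K$; it is complete if it is $p$-adically complete. A $\delta$-subring of $R$ is a subring $\mathcal O$ with $\delta\mathcal O\subset\mathcal O$.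 An extension of integral domains is generically finite if the induced extension of fraction fields is finite. **Theorem.** Let $u_0\in GL_n(R)$ and $\alpha\in\mathfrak{gl}_n(R)$, and let $\Delta$ be arbitrary as above. 1) There is a unique $u\in GL_n(R)$ such that $\delta u=\Delta^\alpha(u)$ and $u\equiv u_0$ mod $p$. Let $u$ be this solution. 2) If $\mathcal O$ is a complete valuation subring of $R$, $u_0$ and $\alpha$ have entries in $\mathcal O$, and $\Delta$ has entries in (the image of) $\mathcal O[x,\det(x)^{-1}]\hat{\ }$, then $u$ has entries in $\mathcal O$. 3) If $\Delta$ is of type $SL_n$, $u_0\in SL_n$ and $\alpha\in\mathfrak{sl}_{n,\delta}$, then $u\in SL_n$. 4) If $\Delta$ is of type $SO(q)$, $u_0\in SO(q)$ and $\alpha\in\mathfrak{so}(q)_\delta$, then $u\in SO(q)$. 5) If $\mathcal O$ is a valuation subring of $R$ that is a $\delta$-subring with finite residue field, $u_0$ and $\alpha$ have entries in $\mathcal O$, and either $\Delta$ is of type $GL_n$, or $\Delta$ is of type $SL_n$ and $u\in SL_n$, then $u$ has entries in a $\delta$-subring $\mathcal O'\supset\mathcal O$ of $R$ that is generically finite over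 $\mathcal O$. -/

import Mathlib

open Matrix

namespace DeltaLinear

noncomputable section

section BaseRing

variable (p : ℕ) [Fact p.Prime]

/-- The ring `R = W(k)`, where `k` is the algebraic closure of `𝔽_p`. -/
abbrev R : Type := WittVector p (AlgebraicClosure (ZMod p))

/-- The lift `φ : R → R` of the `p`-power Frobenius of `k`. -/
def phi : R p →+* R p := WittVector.frobenius

theorem exists_mul_eq_phi_sub_pow (a : R p) : ∃ b : R p, (p : R p) * b = phi p a - a ^ p := by
  have h : phi p a - a ^ p ∈ Ideal.span {(p : R p)} := by
    rw [WittVector.mem_span_p_iff_coeff_zero_eq_zero]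
    change WittVector.constantCoeff (phi p a - a ^ p) = 0
    rw [map_sub, map_pow]
    simp [phi, WittVector.coeff_frobenius_charP]
  obtain ⟨b, hb⟩ := Ideal.mem_span_singleton.1 h
  exact ⟨b, hb.symm⟩

/-- `δ a = (φ a - a ^ p) / p`. -/
def delta (a : R p) : R p := (exists_mul_eq_phi_sub_pow p a).choose

/-- `R` has no `p`-torsion, so this equation characterizes `delta`. -/
theorem mul_delta (a : R p) : (p : R p) * delta p a = phi p a - a ^ p :=
  (exists_mul_eq_phi_sub_pow p a).choose_spec

/-- The canonical map `ℤ_p = W(𝔽_p) → W(k) = R`. -/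
def ofPadicInt : ℤ_[p] →+* R p :=
  (WittVector.map (algebraMap (ZMod p) (AlgebraicClosure (ZMod p)))).comp
    (WittVector.equiv p).symm.toRingHom

end BaseRing

section Coordinates

/-- `𝒪(GL_n) = S[x, det(x)⁻¹]`, with `x` an `n × n` matrix of indeterminates. -/
abbrev Coord (n : ℕ) (S : Type) [CommRing S] : Type :=
  Localization.Away (Matrix.det (Matrix.mvPolynomialX (Fin n) (Fin n) S))

/-- The `p`-adic completion of a commutative ring. -/
abbrev PHat (p : ℕ) (B : Type) [CommRing B] : Type :=
  AdicCompletion (Ideal.span {(p : B)}) B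

/-- `S[x, det(x)⁻¹]^`. -/
abbrev CoordHat (p n : ℕ) (S : Type) [CommRing S] : Type := PHat p (Coord n S)

theorem span_pow_le_comap {B C : Type} [CommRing B] [CommRing C] (p : ℕ) (f : B →+* C) (m : ℕ) :
    Ideal.span {(p : B)} ^ m ≤ (Ideal.span {(p : C)} ^ m).comap f := by
  rw [← Ideal.map_le_iff_le_comap, Ideal.map_pow, Ideal.map_span]
  simp

theorem pHatMap_compat (p : ℕ) {B C : Type} [CommRing B] [CommRing C] (f : B →+* C) {m m' : ℕ}
    (hle : m ≤ m') :
    (Ideal.Quotient.factorPow (Ideal.span {(p : C)}) hle).comp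
      ((Ideal.quotientMap (Ideal.span {(p : C)} ^ m') f (span_pow_le_comap p f m')).comp
        (AdicCompletion.evalₐ (Ideal.span {(p : B)}) m').toRingHom) =
      (Ideal.quotientMap (Ideal.span {(p : C)} ^ m) f (span_pow_le_comap p f m)).comp
        (AdicCompletion.evalₐ (Ideal.span {(p : B)}) m).toRingHom := by
  ext x
  obtain ⟨x, rfl⟩ := AdicCompletion.mk_surjective _ _ x
  have h := (Ideal.Quotient.eq.1 (AdicCompletion.Ideal.mk_eq_mk _ hle x))
  simp only [RingHom.comp_apply, AlgHom.toRingHom_eq_coe, RingHom.coe_coe,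
    AdicCompletion.evalₐ_mk, Ideal.quotientMap_mk]
  rw [Ideal.Quotient.factorPow, Ideal.Quotient.factor_mk, Ideal.Quotient.eq, ← map_sub]
  exact span_pow_le_comap p f m h

/-- The map on `p`-adic completions induced by a ring homomorphism. -/
def pHatMap (p : ℕ) {B C : Type} [CommRing B] [CommRing C] (f : B →+* C) :
    PHat p B →+* PHat p C :=
  AdicCompletion.liftRingHom (Ideal.span {(p : C)})
    (fun m => (Ideal.quotientMap (Ideal.span {(p : C)} ^ m) f (span_pow_le_comap p f m)).comp
      (AdicCompletion.evalₐ (Ideal.span {(p : B)}) m).toRingHom)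
    (fun hle => pHatMap_compat p f hle)

theorem isUnit_eval_det {n : ℕ} {S T : Type} [CommRing S] [CommRing T] (f : S →+* T)
    (u : GL (Fin n) T) :
    IsUnit (MvPolynomial.eval₂Hom f (fun ij : Fin n × Fin n => (u : Matrix _ _ T) ij.1 ij.2)
      (Matrix.det (Matrix.mvPolynomialX (Fin n) (Fin n) S))) := by
  rw [RingHom.map_det, RingHom.mapMatrix_apply]
  have h : (Matrix.mvPolynomialX (Fin n) (Fin n) S).map
      (MvPolynomial.eval₂Hom f (fun ij : Fin n × Fin n => (u : Matrix _ _ T) ij.1 ij.2)) =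
      (u : Matrix _ _ T) := by
    ext i j
    simp
  rw [h]
  exact (Matrix.isUnit_iff_isUnit_det _).1 u.isUnit

/-- The homomorphism `S[x, det(x)⁻¹] → T` extending `f : S → T` and sending `x` to `u`. -/
def coordLift {n : ℕ} {S T : Type} [CommRing S] [CommRing T] (f : S →+* T) (u : GL (Fin n) T) :
    Coord n S →+* T :=
  IsLocalization.Away.lift (Matrix.det (Matrix.mvPolynomialX (Fin n) (Fin n) S))
    (isUnit_eval_det f u)

/-- The matrix of coordinates `x`, with entries in `S[x, det(x)⁻¹]`. -/
def coordX (n : ℕ) (S : Type) [CommRing S] : Matrix (Fin n) (Fin n) (Coord n S) :=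
  (Matrix.mvPolynomialX (Fin n) (Fin n) S).map
    (algebraMap (MvPolynomial (Fin n × Fin n) S) (Coord n S))

theorem isUnit_coordX (n : ℕ) (S : Type) [CommRing S] : IsUnit (coordX n S) := by
  rw [Matrix.isUnit_iff_isUnit_det, coordX, ← RingHom.mapMatrix_apply, ← RingHom.map_det]
  exact IsLocalization.Away.algebraMap_isUnit _

/-- The homomorphism `S[x, det(x)⁻¹] → T[x, det(x)⁻¹]` induced by `f : S → T`. -/
def coordMap (n : ℕ) {S T : Type} [CommRing S] [CommRing T] (f : S →+* T) :
    Coord n S →+* Coord n T :=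
  coordLift ((algebraMap T (Coord n T)).comp f) (isUnit_coordX n T).unit

variable (p : ℕ) [Fact p.Prime]

/-- The value `F(u) ∈ R` of `F ∈ R[x, det(x)⁻¹]^` at `u ∈ GL_n(R)`. -/
def evalHat {n : ℕ} (u : GL (Fin n) (R p)) : CoordHat p n (R p) →+* R p :=
  ((AdicCompletion.ofAlgEquiv (Ideal.span {(p : R p)})).symm :
    PHat p (R p) →+* R p).comp (pHatMap p (coordLift (RingHom.id (R p)) u))

/-- The matrix of coordinates `x`, with entries in `R[x, det(x)⁻¹]^`. -/
def X (n : ℕ) : Matrix (Fin n) (Fin n) (CoordHat p n (R p)) :=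
  (coordX n (R p)).map (algebraMap (Coord n (R p)) (CoordHat p n (R p)))

/-- A constant matrix, viewed with entries in `R[x, det(x)⁻¹]^`. -/
def const {n : ℕ} (α : Matrix (Fin n) (Fin n) (R p)) :
    Matrix (Fin n) (Fin n) (CoordHat p n (R p)) :=
  α.map (algebraMap (R p) (CoordHat p n (R p)))

/-- The entries of `Δ` lie in `𝒪[x, det(x)⁻¹]^`. -/
def DefinedOver {n : ℕ} (O : Subring (R p))
    (Δ : Matrix (Fin n) (Fin n) (CoordHat p n (R p))) : Prop :=
  ∀ i j, Δ i j ∈ (pHatMap p (coordMap n O.subtype)).range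

end Coordinates

section Equations

variable (p : ℕ) [Fact p.Prime] {n : ℕ}

/-- `u^(p)`: the matrix of `p`-th powers of the entries. -/
def frobPow {A : Type} [CommRing A] (u : Matrix (Fin n) (Fin n) A) : Matrix (Fin n) (Fin n) A :=
  u.map (fun a => a ^ p)

/-- `Φ(x) = x^(p) + p Δ(x)`. -/
def Phi (Δ : Matrix (Fin n) (Fin n) (CoordHat p n (R p))) :
    Matrix (Fin n) (Fin n) (CoordHat p n (R p)) :=
  frobPow p (X p n) + p • Δ

/-- `Δ^α(x) = α Φ(x) + Δ(x)`. -/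
def twist (Δ : Matrix (Fin n) (Fin n) (CoordHat p n (R p))) (α : Matrix (Fin n) (Fin n) (R p)) :
    Matrix (Fin n) (Fin n) (CoordHat p n (R p)) :=
  const p α * Phi p Δ + Δ

/-- `u` is a solution of `δ u = Δ^α(u)`. -/
def IsSolution (Δ : Matrix (Fin n) (Fin n) (CoordHat p n (R p)))
    (α : Matrix (Fin n) (Fin n) (R p)) (u : GL (Fin n) (R p)) : Prop :=
  (u : Matrix (Fin n) (Fin n) (R p)).map (delta p) = (twist p Δ α).map (evalHat p u)

/-- `u ≡ v mod p`. -/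
def CongrModP (u v : GL (Fin n) (R p)) : Prop :=
  ∀ i j, (p : R p) ∣ (u : Matrix (Fin n) (Fin n) (R p)) i j - (v : Matrix (Fin n) (Fin n) (R p)) i j

end Equations

section Types

variable (p : ℕ) [Fact p.Prime]

/-- The series `∑ f k` converges `p`-adically to `s`. -/
def HasPadicSum {A : Type} [CommRing A] (f : ℕ → A) (s : A) : Prop :=
  ∀ m : ℕ, ∃ N : ℕ, ∀ M ≥ N, (p : A) ^ m ∣ (∑ k ∈ Finset.range M, f k) - s

/-- `w = z ^ a`, given by the binomial series `∑ (a choose k) (z - 1) ^ k`; for `z = 1 + p t` this is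
the series `(1 + p t) ^ a`. -/
def IsPadicPow {A : Type} [CommRing A] [Algebra (R p) A] (a : ℤ_[p]) (z w : A) : Prop :=
  HasPadicSum p (fun k => algebraMap (R p) A (ofPadicInt p (Ring.choose a k)) * (z - 1) ^ k) w

/-- `W = Z ^ a` for square matrices, given entrywise by the binomial series
`∑ (a choose k) (Z - 1) ^ k`. -/
def IsPadicMatrixPow {A : Type} [CommRing A] [Algebra (R p) A] {n : ℕ} (a : ℤ_[p])
    (Z W : Matrix (Fin n) (Fin n) A) : Prop :=
  ∀ i j, HasPadicSum p
    (fun k => algebraMap (R p) A (ofPadicInt p (Ring.choose a k)) * ((Z - 1) ^ k) i j) (W i j)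

/-- `Δ` is of type `GL_n`. -/
def IsTypeGL {n : ℕ} (Δ : Matrix (Fin n) (Fin n) (CoordHat p n (R p))) : Prop := Δ = 0

/-- `Δ` is of type `SL_n`: `p ∤ n` and `Δ = ((λ - 1) / p) x^(p)`, where
`λ = (det(x^(p)) / det(x)^p) ^ (-1/n)`. The ring `R[x, det(x)⁻¹]^` has no `p`-torsion, so the
equation for `p Δ` determines `Δ`. -/
def IsTypeSL {n : ℕ} (Δ : Matrix (Fin n) (Fin n) (CoordHat p n (R p))) : Prop :=
  ¬ p ∣ n ∧ ∃ lam : CoordHat p n (R p),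
    IsPadicPow p (-Ring.inverse (n : ℤ_[p]))
      ((frobPow p (X p n)).det * Ring.inverse ((X p n).det ^ p)) lam ∧
    p • Δ = (lam - 1) • frobPow p (X p n)

/-- The matrices `q` (over any ring) defining `Sp_{2r}`, `SO_{2r}` and `SO_{2r+1}`. -/
inductive IsClassicalForm {A : Type} [CommRing A] :
    {n : ℕ} → Matrix (Fin n) (Fin n) A → Prop
  | symplectic (r : ℕ) : IsClassicalForm
      (Matrix.reindex finSumFinEquiv finSumFinEquiv
        (Matrix.fromBlocks (0 : Matrix (Fin r) (Fin r) A) 1 (-1) (0 : Matrix (Fin r) (Fin r) A)))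
  | evenOrthogonal (r : ℕ) : IsClassicalForm
      (Matrix.reindex finSumFinEquiv finSumFinEquiv
        (Matrix.fromBlocks (0 : Matrix (Fin r) (Fin r) A) 1 1 (0 : Matrix (Fin r) (Fin r) A)))
  | oddOrthogonal (r : ℕ) : IsClassicalForm
      (Matrix.reindex finSumFinEquiv finSumFinEquiv
        (Matrix.fromBlocks (1 : Matrix (Fin 1) (Fin 1) A) 0 0
          (Matrix.reindex finSumFinEquiv finSumFinEquiv
            (Matrix.fromBlocks (0 : Matrix (Fin r) (Fin r) A) 1 1
              (0 : Matrix (Fin r) (Fin r) A)))))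

/-- `Δ` is of type `SO(q)`: `Δ = x^(p) ((Λ - 1) / p)`, where
`Λ = (((x^(p))ᵗ q x^(p))⁻¹ (xᵗ q x)^(p)) ^ (1/2)`. -/
def IsTypeSO {n : ℕ} (q : Matrix (Fin n) (Fin n) (R p))
    (Δ : Matrix (Fin n) (Fin n) (CoordHat p n (R p))) : Prop :=
  ∃ Lam : Matrix (Fin n) (Fin n) (CoordHat p n (R p)),
    IsPadicMatrixPow p (Ring.inverse (2 : ℤ_[p]))
      (((frobPow p (X p n))ᵀ * const p q * frobPow p (X p n))⁻¹ *
        frobPow p ((X p n)ᵀ * const p q * X p n)) Lam ∧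
    p • Δ = frobPow p (X p n) * (Lam - 1)

variable {n : ℕ}

/-- `SL_n(A)`, as a set of matrices. -/
def SLn {A : Type} [CommRing A] : Set (Matrix (Fin n) (Fin n) A) := {u | u.det = 1}

/-- `SO(q)`, as a set of matrices. For the symplectic form the condition on the determinant is
automatic; for the orthogonal forms, and `2` invertible, it cuts out the identity component of the
group defined by `uᵗ q u = q`. -/
def SOq {A : Type} [CommRing A] (q : Matrix (Fin n) (Fin n) A) : Set (Matrix (Fin n) (Fin n) A) :=
  {u | uᵀ * q * u = q ∧ u.det = 1}

/-- The `δ`-Lie algebra of a subset of `GL_n(R)`: all `α` such that `1 + p α` belongs to it. -/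
def deltaLie (H : Set (Matrix (Fin n) (Fin n) (R p))) : Set (Matrix (Fin n) (Fin n) (R p)) :=
  {α | 1 + p • α ∈ H}

end Types

section Subrings

variable (p : ℕ) [Fact p.Prime]

/-- A subring `𝒪` of `R` with `δ 𝒪 ⊆ 𝒪`. -/
def IsDeltaSubring (O : Subring (R p)) : Prop := ∀ a ∈ O, delta p a ∈ O

/-- A valuation subring of `R`: the intersection of `R` with a subfield of its field of fractions. -/
def IsValuationSubring (O : Subring (R p)) : Prop :=
  ∃ F : Subfield (FractionRing (R p)), ∀ a : R p, a ∈ O ↔ algebraMap (R p) (FractionRing (R p)) a ∈ F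

/-- `𝒪` is `p`-adically complete. -/
def IsPComplete (O : Subring (R p)) : Prop := IsAdicComplete (Ideal.span {(p : O)}) O

/-- `𝒪` is a local ring with finite residue field. -/
def HasFiniteResidueField (O : Subring (R p)) : Prop :=
  ∃ _ : IsLocalRing O, Finite (IsLocalRing.ResidueField O)

/-- The extension `𝒪 ⊆ 𝒪'` is generically finite: the induced extension of fraction fields is
finite. -/
def IsGenericallyFinite {O O' : Subring (R p)} (h : O ≤ O') : Prop :=
  (IsFractionRing.map (K := FractionRing O) (L := FractionRing O')
    (Subring.inclusion_injective h)).Finite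

/-- The entries of `u` lie in `𝒪`. -/
def EntriesIn {n : ℕ} (O : Subring (R p)) (u : Matrix (Fin n) (Fin n) (R p)) : Prop :=
  ∀ i j, u i j ∈ O

end Subrings

end

end DeltaLinear

/-! Multiplying `δu = Δ^α(u)` by `p` and adding `u^(p)` turns it into `φ(u) = (1 + pα)Φ(u)`
(`isSolution_iff`). Since `φ` is bijective on `R` and fixes `p`, solutions are the fixed points of
`u ↦ φ⁻¹((1 + pα)Φ(u))`. This map preserves residue classes mod `p` and improves a congruence mod
`p^m`, `m ≥ 1`, to one mod `p^(m+1)` (`twisted_contraction`). Existence and uniqueness follow. Over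
a complete valuation subring `𝒪`, which is closed in `R` and closed under `φ⁻¹`, the iteration
started at `u₀` never leaves `𝒪`.

Parts 3 and 4 use that an element with `φ(a) = a^p` is determined by its residue
(`eq_of_phi_eq_pow`). The types are designed so that `det Φ(u) = det(u)^p`, respectively `Φ(u)ᵗqΦ(u)
= (uᵗqu)^(p)` (`IsTypeSO.Phi_form`). Hence `det u`, respectively the entries of `uᵗqu`, satisfy this
equation, and their residues come from `u₀`. Identities for `p`-adic powers are obtained by
approximating the exponent by natural numbers (`exists_pow_approx`).

For part 5, a finite residue field makes some `φ^f`, `f ≥ 1`, trivial on `𝒪`. Then `φ^f(u)` solves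
the same equation with the same residue, so `φ^f(u) = u`. Unrolling `φ(u) = w(1 + pα)u^(p)` gives `u
= μv`, with `v` obtained from `u` by repeated `p`-th powers and multiplication by matrices over `𝒪`.
Here `μ = 1` for type `GL_n`, and `μ^n det v = 1` for type `SL_n`. Each `p`-th power contributes a
factor `p` to differentials, so the module `N` generated by `du` and `dμ` satisfies `N = pN`.
Nakayama gives `N = 0` (`derivation_eq_zero_of_frobIter`). A finitely generated field extension
without differentials on its generators is finite here, so `u` is algebraic. Adjoining the finite
`φ`-orbit of its entries and intersecting with `R` yields `𝒪'`. -/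

namespace DeltaLinear

/-! ### Congruences of matrices and entrywise `p`-th powers -/

section Congruence

variable {A B : Type} [CommRing A] [CommRing B] {n : ℕ}

/-- Entrywise congruence of matrices modulo `c`. -/
def MatCongr (c : A) (M N : Matrix (Fin n) (Fin n) A) : Prop := ∀ i j, c ∣ M i j - N i j

theorem matCongr_iff_map_mk {c : A} {M N : Matrix (Fin n) (Fin n) A} :
    MatCongr c M N ↔
      M.map (Ideal.Quotient.mk (Ideal.span {c})) = N.map (Ideal.Quotient.mk (Ideal.span {c})) := by
  simp only [MatCongr, ← Matrix.ext_iff, Matrix.map_apply, Ideal.Quotient.eq,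
    Ideal.mem_span_singleton]

theorem MatCongr.refl (c : A) (M : Matrix (Fin n) (Fin n) A) : MatCongr c M M := fun i j => by simp

theorem MatCongr.symm {c : A} {M N : Matrix (Fin n) (Fin n) A} (h : MatCongr c M N) :
    MatCongr c N M := fun i j => (dvd_sub_comm).1 (h i j)

theorem MatCongr.trans {c : A} {M N P : Matrix (Fin n) (Fin n) A} (h : MatCongr c M N)
    (h' : MatCongr c N P) : MatCongr c M P := fun i j => by
  simpa using dvd_add (h i j) (h' i j)

theorem MatCongr.of_dvd {c d : A} {M N : Matrix (Fin n) (Fin n) A} (h : MatCongr c M N)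
    (hd : d ∣ c) : MatCongr d M N := fun i j => hd.trans (h i j)

theorem MatCongr.mul {c : A} {M N M' N' : Matrix (Fin n) (Fin n) A} (h : MatCongr c M N)
    (h' : MatCongr c M' N') : MatCongr c (M * M') (N * N') := by
  rw [matCongr_iff_map_mk] at *
  rw [Matrix.map_mul, Matrix.map_mul, h, h']

theorem MatCongr.transpose {c : A} {M N : Matrix (Fin n) (Fin n) A} (h : MatCongr c M N) :
    MatCongr c Mᵀ Nᵀ := fun i j => h j i

theorem MatCongr.det {c : A} {M N : Matrix (Fin n) (Fin n) A} (h : MatCongr c M N) :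
    c ∣ M.det - N.det := by
  rw [matCongr_iff_map_mk] at h
  have := congrArg Matrix.det h
  rw [← RingHom.mapMatrix_apply, ← RingHom.mapMatrix_apply, ← RingHom.map_det,
    ← RingHom.map_det, Ideal.Quotient.eq, Ideal.mem_span_singleton] at this
  exact this

theorem MatCongr.map (f : A →+* B) {c : A} {M N : Matrix (Fin n) (Fin n) A} (h : MatCongr c M N) :
    MatCongr (A := B) (f c) (M.map f) (N.map f) := fun i j => by
  simpa using map_dvd f (h i j)

/-- In the expansion of `(b + p^m c)^p` the linear term gains a factor `p` from its coefficient. The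
rest is divisible by `p^(2m)`, and `2m ≥ m + 1` because `m ≠ 0`. -/
theorem pow_dvd_pow_sub_pow {p : ℕ} {a b : A} {m : ℕ} (hm : m ≠ 0)
    (h : (p : A) ^ m ∣ a - b) : (p : A) ^ (m + 1) ∣ a ^ p - b ^ p := by
  obtain ⟨c, hc⟩ := h
  obtain ⟨k, hk⟩ := Polynomial.powAddExpansion b ((p : A) ^ m * c) p
  have h2 : (p : A) ^ (m + 1) ∣ ((p : A) ^ m * c) ^ 2 := by
    rw [mul_pow, ← pow_mul]
    exact (pow_dvd_pow _ (by omega)).mul_right _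
  rw [show a = b + (p : A) ^ m * c by rw [← hc]; ring, hk, add_assoc, add_sub_cancel_left]
  exact dvd_add ⟨b ^ (p - 1) * c, by ring⟩ (h2.mul_left _)

theorem MatCongr.frobPow {p m : ℕ} (hm : m ≠ 0) {M N : Matrix (Fin n) (Fin n) A}
    (h : MatCongr ((p : A) ^ m) M N) :
    MatCongr ((p : A) ^ (m + 1)) (frobPow p M) (frobPow p N) :=
  fun i j => pow_dvd_pow_sub_pow hm (h i j)

theorem frobPow_map {p : ℕ} (f : A →+* B) (M : Matrix (Fin n) (Fin n) A) :
    (frobPow p M).map f = frobPow p (M.map f) := by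
  ext; simp [frobPow]

/-- Once Frobenius mod `p` is a ring homomorphism, its compatibility with products and determinants
is automatic. The case split is needed because `A/p` has characteristic `p` only if it is nonzero.
-/
theorem exists_ringHom_pow (p : ℕ) [Fact p.Prime] (A : Type) [CommRing A] :
    ∃ g : A →+* A ⧸ Ideal.span {(p : A)}, ∀ a, g a = Ideal.Quotient.mk _ (a ^ p) := by
  by_cases hp : IsUnit (p : A)
  · have : Subsingleton (A ⧸ Ideal.span {(p : A)}) := by
      rw [Ideal.Quotient.subsingleton_iff, Ideal.span_singleton_eq_top]; exact hp
    exact ⟨Ideal.Quotient.mk _, fun a => Subsingleton.elim _ _⟩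
  · have := CharP.quotient A p hp
    exact ⟨(frobenius _ p).comp (Ideal.Quotient.mk _), fun a => by simp [frobenius_def]⟩

theorem frobPow_mul_congr (p : ℕ) [Fact p.Prime] (M N : Matrix (Fin n) (Fin n) A) :
    MatCongr (p : A) (frobPow p (M * N)) (frobPow p M * frobPow p N) := by
  obtain ⟨g, hg⟩ := exists_ringHom_pow p A
  have key : ∀ P : Matrix (Fin n) (Fin n) A, (frobPow p P).map (Ideal.Quotient.mk _) = P.map g :=
    fun P => by ext; simp [frobPow, hg]
  rw [matCongr_iff_map_mk, Matrix.map_mul, key, key, key, Matrix.map_mul]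

theorem dvd_det_frobPow_sub (p : ℕ) [Fact p.Prime] (M : Matrix (Fin n) (Fin n) A) :
    (p : A) ∣ (frobPow p M).det - M.det ^ p := by
  obtain ⟨g, hg⟩ := exists_ringHom_pow p A
  have key : (frobPow p M).map (Ideal.Quotient.mk _) = M.map g := by ext; simp [frobPow, hg]
  rw [← Ideal.mem_span_singleton, ← Ideal.Quotient.eq, ← hg, RingHom.map_det, RingHom.map_det,
    RingHom.mapMatrix_apply, key, RingHom.mapMatrix_apply]

theorem frobPow_transpose {p : ℕ} (M : Matrix (Fin n) (Fin n) A) :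
    frobPow p Mᵀ = (frobPow p M)ᵀ := rfl

theorem exists_forall_pow_dvd_sub {A : Type} [CommRing A] {p : ℕ}
    [IsPrecomplete (Ideal.span {(p : A)}) A] {s : ℕ → A} (h : ∀ m, (p : A) ^ m ∣ s (m + 1) - s m) :
    ∃ l, ∀ m, (p : A) ^ m ∣ l - s m := by
  have h' : ∀ {m k : ℕ}, m ≤ k → s m ≡ s k [SMOD (Ideal.span {(p : A)} ^ m • ⊤ : Submodule (A) (A))] := by
    intro m k hmk
    rw [SModEq.sub_mem, smul_eq_mul, Ideal.mul_top, Ideal.span_singleton_pow,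
      Ideal.mem_span_singleton]
    induction k, hmk using Nat.le_induction with
    | base => simp
    | succ k hk ih =>
      have := dvd_sub ih ((pow_dvd_pow _ hk).trans (h k))
      simpa using this
  obtain ⟨l, hl⟩ := IsPrecomplete.prec (I := Ideal.span {(p : A)}) (M := A) ‹_› h'
  refine ⟨l, fun m => ?_⟩
  have := (hl m).symm
  rwa [SModEq.sub_mem, smul_eq_mul, Ideal.mul_top, Ideal.span_singleton_pow,
    Ideal.mem_span_singleton] at this

end Congruence

/-! ### Divisibility by `p` and Frobenius on `R` -/

section BaseRing

variable {p : ℕ} [Fact p.Prime]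

theorem natCast_p_ne_zero : (p : R p) ≠ 0 := WittVector.p_nonzero p _

theorem phi_bijective : Function.Bijective (phi p) := WittVector.frobenius_bijective p _

theorem pow_dvd_of_pow_dvd_phi {m : ℕ} {a : R p} (h : (p : R p) ^ m ∣ phi p a) :
    (p : R p) ^ m ∣ a := by
  obtain ⟨b, hb⟩ := h
  obtain ⟨c, rfl⟩ := phi_bijective.2 b
  exact ⟨c, phi_bijective.1 (by rw [hb]; simp)⟩

theorem eq_of_forall_pow_dvd_sub {a b : R p} (h : ∀ m : ℕ, (p : R p) ^ m ∣ a - b) : a = b := by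
  rw [← sub_eq_zero]
  refine IsHausdorff.haus (I := Ideal.span {(p : R p)}) (M := R p) inferInstance _ fun m => ?_
  rw [SModEq.zero, smul_eq_mul, Ideal.mul_top, Ideal.span_singleton_pow,
    Ideal.mem_span_singleton]
  exact h m

theorem dvd_iff_coeff_zero {a : R p} : (p : R p) ∣ a ↔ a.coeff 0 = 0 := by
  rw [← Ideal.mem_span_singleton, WittVector.mem_span_p_iff_coeff_zero_eq_zero]

theorem isUnit_of_not_dvd {a : R p} (h : ¬ (p : R p) ∣ a) : IsUnit a :=
  WittVector.isUnit_of_coeff_zero_ne_zero a (mt dvd_iff_coeff_zero.2 h)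

theorem not_isUnit_natCast_p : ¬ IsUnit (p : R p) := (WittVector.irreducible p).not_isUnit

theorem isUnit_of_dvd_sub {a b : R p} (hb : IsUnit b) (h : (p : R p) ∣ a - b) : IsUnit a := by
  refine isUnit_of_not_dvd fun ha => ?_
  exact not_isUnit_natCast_p (isUnit_of_dvd_unit ((dvd_sub_right ha).1 h) hb)

theorem pow_succ_dvd_mul {m : ℕ} {a : R p} (h : (p : R p) ^ m ∣ a) :
    (p : R p) ^ (m + 1) ∣ (p : R p) * a := by
  rw [pow_succ']; exact mul_dvd_mul_left _ h

/-- A congruence mod `p^m` improves under `p`-th powers, hence under `φ`, and pulls back along the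
bijection `φ`. Repeating this gives congruence modulo all powers of `p`. -/
theorem eq_of_phi_eq_pow {a b : R p} (ha : phi p a = a ^ p) (hb : phi p b = b ^ p)
    (h : (p : R p) ∣ a - b) : a = b := by
  have key : ∀ m : ℕ, (p : R p) ^ (m + 1) ∣ a - b := by
    intro m
    induction m with
    | zero => simpa using h
    | succ m ih =>
      refine pow_dvd_of_pow_dvd_phi ?_
      rw [map_sub, ha, hb]
      exact pow_dvd_pow_sub_pow (by simp) ih
  exact eq_of_forall_pow_dvd_sub fun m => (pow_dvd_pow _ (by simp)).trans (key m)

theorem delta_eq_iff {a b : R p} : delta p a = b ↔ phi p a = a ^ p + p * b := by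
  rw [← mul_right_inj' (natCast_p_ne_zero (p := p)), mul_delta, sub_eq_iff_eq_add, add_comm]

end BaseRing

/-! ### Evaluation of completed functions at points of `GL_n(R)` -/

section Evaluation

variable {p : ℕ}

theorem quotient_mk_eq_iff {B : Type*} [CommRing B] {a b : B} {m : ℕ} :
    Ideal.Quotient.mk (Ideal.span {(p : B)} ^ m) a = Ideal.Quotient.mk _ b ↔ (p : B) ^ m ∣ a - b := by
  rw [Ideal.Quotient.eq, Ideal.span_singleton_pow, Ideal.mem_span_singleton]

theorem evalₐ_pHatMap {B C : Type} [CommRing B] [CommRing C] (f : B →+* C) (m : ℕ)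
    {F : PHat p B} {b : B} (hF : AdicCompletion.evalₐ (Ideal.span {(p : B)}) m F =
      Ideal.Quotient.mk _ b) :
    AdicCompletion.evalₐ (Ideal.span {(p : C)}) m (pHatMap p f F) = Ideal.Quotient.mk _ (f b) := by
  rw [pHatMap, AdicCompletion.evalₐ_liftRingHom]
  simp only [RingHom.comp_apply, AlgHom.toRingHom_eq_coe, RingHom.coe_coe, hF,
    Ideal.quotientMap_mk]

theorem exists_evalₐ_eq_mk {B : Type} [CommRing B] (m : ℕ) (F : PHat p B) : ∃ b : B,
    AdicCompletion.evalₐ (Ideal.span {(p : B)}) m F = Ideal.Quotient.mk _ b := by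
  obtain ⟨b, hb⟩ := Ideal.Quotient.mk_surjective (AdicCompletion.evalₐ (Ideal.span {(p : B)}) m F)
  exact ⟨b, hb.symm⟩

variable {n : ℕ} [Fact p.Prime]

/-- Modulo `p^m` an element of the completion may be replaced by any representative in the
uncompleted ring; this reduces evaluation to `coordLift`. -/
theorem dvd_evalHat_sub (u : GL (Fin n) (R p)) {m : ℕ} {F : CoordHat p n (R p)}
    {c : Coord n (R p)} (hF : AdicCompletion.evalₐ (Ideal.span {(p : Coord n (R p))}) m F =
      Ideal.Quotient.mk _ c) :
    (p : R p) ^ m ∣ evalHat p u F - coordLift (RingHom.id _) u c := by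
  rw [← quotient_mk_eq_iff, ← evalₐ_pHatMap (coordLift (RingHom.id _) u) m hF]
  exact AdicCompletion.mk_ofAlgEquiv_symm _ _ _

theorem evalHat_algebraMap_coord (u : GL (Fin n) (R p)) (c : Coord n (R p)) :
    evalHat p u (algebraMap (Coord n (R p)) (CoordHat p n (R p)) c) =
      coordLift (RingHom.id _) u c :=
  eq_of_forall_pow_dvd_sub fun _ => dvd_evalHat_sub u (AdicCompletion.evalₐ_of _ _ _)

theorem coordLift_algebraMap {S T : Type} [CommRing S] [CommRing T] (f : S →+* T)
    (u : GL (Fin n) T) (P : MvPolynomial (Fin n × Fin n) S) :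
    coordLift f u (algebraMap _ _ P) =
      MvPolynomial.eval₂Hom f (fun ij => (u : Matrix _ _ T) ij.1 ij.2) P :=
  IsLocalization.Away.lift_eq _ _ _

theorem coordLift_algebraMap_base {S T : Type} [CommRing S] [CommRing T] (f : S →+* T)
    (u : GL (Fin n) T) (s : S) : coordLift f u (algebraMap S (Coord n S) s) = f s := by
  rw [IsScalarTower.algebraMap_apply S (MvPolynomial (Fin n × Fin n) S) (Coord n S),
    coordLift_algebraMap]
  simp

theorem coordX_map_coordLift {S T : Type} [CommRing S] [CommRing T] (f : S →+* T)
    (u : GL (Fin n) T) : (coordX n S).map (coordLift f u) = u.val := by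
  ext i j
  simp [coordX, coordLift_algebraMap]

theorem coord_ringHom_ext {S T : Type} [CommRing S] [CommRing T] {f g : Coord n S →+* T}
    (hS : f.comp (algebraMap S _) = g.comp (algebraMap S _))
    (hX : (coordX n S).map f = (coordX n S).map g) : f = g := by
  refine IsLocalization.ringHom_ext
    (Submonoid.powers (Matrix.det (Matrix.mvPolynomialX (Fin n) (Fin n) S))) ?_
  refine MvPolynomial.ringHom_ext (fun s => ?_) (fun ij => ?_)
  · simpa [IsScalarTower.algebraMap_apply S (MvPolynomial (Fin n × Fin n) S) (Coord n S)]
      using congrArg (fun h => h s) hS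
  · simpa [coordX] using congrFun (congrFun hX ij.1) ij.2

theorem ringHom_comp_coordLift {S T U : Type} [CommRing S] [CommRing T] [CommRing U] (f : S →+* T)
    (g : T →+* U) (u : GL (Fin n) T) :
    g.comp (coordLift f u) = coordLift (g.comp f) (Matrix.GeneralLinearGroup.map g u) := by
  refine coord_ringHom_ext ?_ ?_
  · ext s; simp [coordLift_algebraMap_base]
  · have : (coordX n S).map (g.comp (coordLift f u)) = ((coordX n S).map (coordLift f u)).map g := by
      ext; simp
    rw [this, coordX_map_coordLift, coordX_map_coordLift]
    rfl

/-- The two points have the same image in `GL_n(R/c)`, and evaluation followed by reduction depends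
only on that image. -/
theorem coordLift_congr {c : R p} {u v : GL (Fin n) (R p)} (h : MatCongr c u.val v.val)
    (a : Coord n (R p)) :
    c ∣ coordLift (RingHom.id _) u a - coordLift (RingHom.id _) v a := by
  rw [← Ideal.mem_span_singleton, ← Ideal.Quotient.eq]
  have := ringHom_comp_coordLift (RingHom.id _) (Ideal.Quotient.mk (Ideal.span {c})) u
  have h2 := ringHom_comp_coordLift (RingHom.id _) (Ideal.Quotient.mk (Ideal.span {c})) v
  have h3 : Matrix.GeneralLinearGroup.map (Ideal.Quotient.mk (Ideal.span {c})) u =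
      Matrix.GeneralLinearGroup.map (Ideal.Quotient.mk (Ideal.span {c})) v :=
    Units.ext (matCongr_iff_map_mk.1 h)
  rw [h3, ← h2] at this
  exact congrArg (fun g => g a) this

theorem evalHat_congr {m : ℕ} {u v : GL (Fin n) (R p)} (h : MatCongr ((p : R p) ^ m) u.val v.val)
    (F : CoordHat p n (R p)) : (p : R p) ^ m ∣ evalHat p u F - evalHat p v F := by
  obtain ⟨c, hc⟩ := exists_evalₐ_eq_mk m F
  have := dvd_sub (dvd_add (dvd_evalHat_sub u hc) (coordLift_congr h c)) (dvd_evalHat_sub v hc)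
  simpa using this

theorem X_map_evalHat (u : GL (Fin n) (R p)) : (X p n).map (evalHat p u) = u.val := by
  rw [← coordX_map_coordLift (RingHom.id _) u]
  ext i j
  simp [X, evalHat_algebraMap_coord]

theorem evalHat_algebraMap (u : GL (Fin n) (R p)) (a : R p) :
    evalHat p u (algebraMap (R p) (CoordHat p n (R p)) a) = a :=
  (evalHat_algebraMap_coord u _).trans (coordLift_algebraMap_base _ _ _)

theorem const_map_evalHat (u : GL (Fin n) (R p)) (α : Matrix (Fin n) (Fin n) (R p)) :
    (const p α).map (evalHat p u) = α := by
  ext i j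
  simp [const, evalHat_algebraMap]

theorem Phi_map_evalHat (Δ : Matrix (Fin n) (Fin n) (CoordHat p n (R p))) (u : GL (Fin n) (R p)) :
    (Phi p Δ).map (evalHat p u) = frobPow p u.val + p • Δ.map (evalHat p u) := by
  rw [← X_map_evalHat u, ← frobPow_map]
  refine Matrix.ext fun i j => ?_
  simp only [Phi, Matrix.add_apply, Matrix.smul_apply, Matrix.map_apply, map_add, map_nsmul]

/-- Obtained by multiplying by `p`, which is not a zero divisor, and adding `u^(p)`. All later
arguments use this form. -/
theorem isSolution_iff {Δ : Matrix (Fin n) (Fin n) (CoordHat p n (R p))}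
    {α : Matrix (Fin n) (Fin n) (R p)} {u : GL (Fin n) (R p)} :
    IsSolution p Δ α u ↔
      u.val.map (phi p) = (1 + p • α) * (Phi p Δ).map (evalHat p u) := by
  have h : (twist p Δ α).map (evalHat p u) =
      α * (Phi p Δ).map (evalHat p u) + Δ.map (evalHat p u) := by
    rw [twist, Matrix.map_add _ (map_add _), Matrix.map_mul, const_map_evalHat]
  rw [IsSolution, h, add_mul, one_mul, Matrix.smul_mul]
  -- Only the free-standing `Φ(u)` is expanded; the copies multiplied by `α` match as they are.
  nth_rw 2 [Phi_map_evalHat]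
  simp only [← Matrix.ext_iff, Matrix.map_apply, delta_eq_iff]
  refine forall₂_congr fun i j => ?_
  simp only [frobPow, Matrix.add_apply, Matrix.smul_apply, Matrix.map_apply]
  rw [nsmul_eq_mul, nsmul_eq_mul, mul_add, ← add_assoc, add_right_comm]

/-- Both summands of `Φ` gain one power of `p`: `u^(p)` by the binomial expansion, `pΔ(u)` from its
explicit factor. -/
theorem Phi_congr {Δ : Matrix (Fin n) (Fin n) (CoordHat p n (R p))} {m : ℕ} (hm : m ≠ 0)
    {u v : GL (Fin n) (R p)} (h : MatCongr ((p : R p) ^ m) u.val v.val) :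
    MatCongr ((p : R p) ^ (m + 1)) ((Phi p Δ).map (evalHat p u)) ((Phi p Δ).map (evalHat p v)) := by
  rw [Phi_map_evalHat, Phi_map_evalHat]
  intro i j
  have h1 := h.frobPow hm i j
  have h2 := pow_succ_dvd_mul (evalHat_congr h (Δ i j))
  simp only [Matrix.add_apply, Matrix.smul_apply, Matrix.map_apply]
  rw [nsmul_eq_mul, nsmul_eq_mul, add_sub_add_comm, ← mul_sub]
  exact dvd_add h1 h2

end Evaluation

/-! ### The contraction and its fixed point -/

section Existence

variable {p : ℕ} [Fact p.Prime] {n : ℕ}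

theorem exists_val_eq_of_matCongr {M : Matrix (Fin n) (Fin n) (R p)} {u : GL (Fin n) (R p)}
    (h : MatCongr (p : R p) M u.val) : ∃ v : GL (Fin n) (R p), v.val = M :=
  ⟨Matrix.GeneralLinearGroup.mk'' M
    (isUnit_of_dvd_sub ((Matrix.isUnit_iff_isUnit_det _).1 u.isUnit) h.det), rfl⟩

theorem exists_map_phi_eq (M : Matrix (Fin n) (Fin n) (R p)) :
    ∃ N : Matrix (Fin n) (Fin n) (R p), N.map (phi p) = M := by
  choose g hg using (phi_bijective (p := p)).2
  exact ⟨M.map g, by ext1 i j; simp [hg]⟩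

theorem matCongr_of_map_phi {M N : Matrix (Fin n) (Fin n) (R p)} {m : ℕ}
    (h : MatCongr ((p : R p) ^ m) (M.map (phi p)) (N.map (phi p))) :
    MatCongr ((p : R p) ^ m) M N :=
  fun i j => pow_dvd_of_pow_dvd_phi (by simpa using h i j)

theorem matCongr_of_le {M N : Matrix (Fin n) (Fin n) (R p)} {m k : ℕ} (hmk : m ≤ k)
    (h : MatCongr ((p : R p) ^ k) M N) : MatCongr ((p : R p) ^ m) M N :=
  h.of_dvd (pow_dvd_pow _ hmk)

theorem matCongr_one_add_smul (α : Matrix (Fin n) (Fin n) (R p)) :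
    MatCongr (p : R p) (1 + p • α) 1 := fun i j => by
  simp only [Matrix.add_apply, Matrix.smul_apply, add_sub_cancel_left]
  rw [nsmul_eq_mul]
  exact dvd_mul_right _ _

theorem map_phi_congr_frobPow (M : Matrix (Fin n) (Fin n) (R p)) :
    MatCongr (p : R p) (M.map (phi p)) (frobPow p M) :=
  fun i j => ⟨delta p (M i j), (mul_delta p _).symm⟩

theorem twisted_Phi_congr (Δ : Matrix (Fin n) (Fin n) (CoordHat p n (R p)))
    (α : Matrix (Fin n) (Fin n) (R p)) (u : GL (Fin n) (R p)) :
    MatCongr (p : R p) ((1 + p • α) * (Phi p Δ).map (evalHat p u)) (u.val.map (phi p)) := by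
  have h1 : MatCongr (p : R p) ((Phi p Δ).map (evalHat p u)) (u.val.map (phi p)) := by
    refine MatCongr.trans (fun i j => ?_) (map_phi_congr_frobPow u.val).symm
    rw [Phi_map_evalHat]
    simp only [Matrix.add_apply, Matrix.smul_apply, add_sub_cancel_left]
    rw [nsmul_eq_mul]
    exact dvd_mul_right _ _
  simpa using (matCongr_one_add_smul α).mul h1

theorem exists_map_phi_eq_twisted_Phi (Δ : Matrix (Fin n) (Fin n) (CoordHat p n (R p)))
    (α : Matrix (Fin n) (Fin n) (R p)) (u : GL (Fin n) (R p)) :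
    ∃ v : GL (Fin n) (R p), v.val.map (phi p) = (1 + p • α) * (Phi p Δ).map (evalHat p u) ∧
      MatCongr (p : R p) v.val u.val := by
  obtain ⟨N, hN⟩ := exists_map_phi_eq ((1 + p • α) * (Phi p Δ).map (evalHat p u))
  have hc : MatCongr (p : R p) N u.val := by
    rw [← pow_one (p : R p)]
    refine matCongr_of_map_phi ?_
    rw [hN, pow_one]
    exact twisted_Phi_congr Δ α u
  obtain ⟨v, hv⟩ := exists_val_eq_of_matCongr hc
  exact ⟨v, by rw [hv, hN], by rw [hv]; exact hc⟩

/-- Stated for arbitrary images `u'`, `v'` so that it covers successive iterates, two fixed points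
(`u' = u`, `v' = v`), and a fixed point against an iterate. -/
theorem twisted_contraction {Δ : Matrix (Fin n) (Fin n) (CoordHat p n (R p))}
    {α : Matrix (Fin n) (Fin n) (R p)} {m : ℕ} {u v u' v' : GL (Fin n) (R p)}
    (h : MatCongr ((p : R p) ^ (m + 1)) u.val v.val)
    (hu : u'.val.map (phi p) = (1 + p • α) * (Phi p Δ).map (evalHat p u))
    (hv : v'.val.map (phi p) = (1 + p • α) * (Phi p Δ).map (evalHat p v)) :
    MatCongr ((p : R p) ^ (m + 2)) u'.val v'.val := by
  refine matCongr_of_map_phi ?_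
  rw [hu, hv]
  exact (MatCongr.refl _ _).mul (Phi_congr (by simp) h)

theorem eq_of_forall_matCongr {M N : Matrix (Fin n) (Fin n) (R p)}
    (h : ∀ m : ℕ, MatCongr ((p : R p) ^ (m + 1)) M N) : M = N :=
  Matrix.ext fun i j => eq_of_forall_pow_dvd_sub fun m => matCongr_of_le (Nat.le_succ m) (h m) i j

theorem eq_of_isSolution {Δ : Matrix (Fin n) (Fin n) (CoordHat p n (R p))}
    {α : Matrix (Fin n) (Fin n) (R p)} {u v : GL (Fin n) (R p)} (hu : IsSolution p Δ α u)
    (hv : IsSolution p Δ α v) (h : MatCongr (p : R p) u.val v.val) : u = v := by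
  rw [isSolution_iff] at hu hv
  refine Units.ext (eq_of_forall_matCongr fun m => ?_)
  induction m with
  | zero => simpa using h
  | succ m ih => exact twisted_contraction ih hu hv

theorem exists_isSolution (Δ : Matrix (Fin n) (Fin n) (CoordHat p n (R p)))
    (α : Matrix (Fin n) (Fin n) (R p)) (u₀ : GL (Fin n) (R p)) :
    ∃ u : GL (Fin n) (R p), IsSolution p Δ α u ∧ MatCongr (p : R p) u.val u₀.val := by
  choose T hT hTc using exists_map_phi_eq_twisted_Phi Δ α
  have hstep : ∀ m : ℕ, MatCongr ((p : R p) ^ (m + 1)) (T^[m + 1] u₀).val (T^[m] u₀).val := by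
    intro m
    induction m with
    | zero => simpa using hTc u₀
    | succ m ih =>
      rw [Function.iterate_succ_apply' T (m + 1), Function.iterate_succ_apply' T m] at *
      exact twisted_contraction ih (hT _) (hT _)
  have hlim : ∀ i j, ∃ l : R p, ∀ m, (p : R p) ^ m ∣ l - (T^[m] u₀).val i j := fun i j =>
    exists_forall_pow_dvd_sub (s := fun m => (T^[m] u₀).val i j)
      fun m => matCongr_of_le (Nat.le_succ m) (hstep m) i j
  choose l hl using hlim
  have hl' : ∀ m, MatCongr ((p : R p) ^ m) (Matrix.of l) (T^[m] u₀).val := fun m i j => hl i j m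
  have hl0 : MatCongr (p : R p) (Matrix.of l) u₀.val := by
    have := (hl' 1).trans (by simpa using hstep 0)
    simpa using this
  obtain ⟨u, hu⟩ := exists_val_eq_of_matCongr hl0
  rw [← hu] at hl' hl0
  refine ⟨u, isSolution_iff.2 (eq_of_forall_matCongr fun m => ?_), hl0⟩
  -- The iterate of index `m + 2` has Frobenius `(1 + pα)Φ` of the iterate of index `m + 1`, so
  -- approximating the limit at these two indices compares both sides of the equation.
  have h1 := (hl' (m + 2)).map (phi p)
  rw [Function.iterate_succ_apply', hT, map_pow, map_natCast] at h1
  have h2 := Phi_congr (Δ := Δ) (by simp) (hl' (m + 1))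
  exact matCongr_of_le (by omega) (h1.trans ((MatCongr.refl _ _).mul h2.symm))

end Existence

/-! ### Teichmüller representatives and their approximation by powers -/

section Teichmuller

variable {p : ℕ} [Fact p.Prime]

theorem phi_teichmuller (x : AlgebraicClosure (ZMod p)) :
    phi p (WittVector.teichmuller p x) = WittVector.teichmuller p x ^ p := by
  rw [phi, WittVector.frobenius_eq_map_frobenius, WittVector.map_teichmuller, frobenius_def,
    map_pow]

theorem phi_pow_teichmuller (x : AlgebraicClosure (ZMod p)) (f : ℕ) :
    (phi p ^ f) (WittVector.teichmuller p x) = WittVector.teichmuller p x ^ p ^ f := by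
  induction f with
  | zero => simp
  | succ f ih => rw [pow_succ', RingHom.mul_def, RingHom.comp_apply, ih, map_pow, phi_teichmuller,
      ← pow_mul, pow_succ']

/-- Raising `a ≡ [a₀] mod p` to the power `p^(fm)` fixes `[a₀]` and improves the congruence. The
point is that these powers of `a` stay in any subring containing `a`, while `[a₀]` need not. -/
theorem pow_dvd_pow_sub_teichmuller {a : R p} {f : ℕ} (hf : f ≠ 0)
    (ha : a.coeff 0 ^ p ^ f = a.coeff 0) (m : ℕ) :
    (p : R p) ^ (m + 1) ∣ a ^ p ^ (f * m) - WittVector.teichmuller p (a.coeff 0) := by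
  have hT : WittVector.teichmuller p (a.coeff 0) ^ p ^ (f * m) =
      WittVector.teichmuller p (a.coeff 0) := by
    induction m with
    | zero => simp
    | succ m ih => rw [mul_add, mul_one, pow_add, pow_mul, ih, ← map_pow, ha]
  have h : (p : R p) ∣ a - WittVector.teichmuller p (a.coeff 0) := by
    rw [dvd_iff_coeff_zero]
    change WittVector.constantCoeff (a - WittVector.teichmuller p (a.coeff 0)) = 0
    rw [map_sub]
    simp
  have := dvd_sub_pow_of_dvd_sub h (f * m)
  rw [hT] at this
  exact (pow_dvd_pow _ (by nlinarith [Nat.one_le_iff_ne_zero.2 hf])).trans this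

theorem exists_pow_eq_self (x : AlgebraicClosure (ZMod p)) : ∃ f : ℕ, f ≠ 0 ∧ x ^ p ^ f = x := by
  have hx : IsIntegral (ZMod p) x := Algebra.IsIntegral.isIntegral x
  have : FiniteDimensional (ZMod p) (IntermediateField.adjoin (ZMod p) {x}) :=
    IntermediateField.adjoin.finiteDimensional hx
  have : Finite (IntermediateField.adjoin (ZMod p) {x}) := Module.finite_of_finite (ZMod p)
  have := Fintype.ofFinite (IntermediateField.adjoin (ZMod p) {x})
  refine ⟨_, (Module.finrank_pos (R := ZMod p)
    (M := IntermediateField.adjoin (ZMod p) {x})).ne', ?_⟩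
  have h := FiniteField.pow_card (IntermediateField.AdjoinSimple.gen (ZMod p) x)
  rw [Module.card_eq_pow_finrank (K := ZMod p), ZMod.card] at h
  simpa using congrArg Subtype.val h

end Teichmuller

/-! ### Valuation subrings: closedness, Frobenius and descent of solutions -/

section ValuationSubring

variable {p : ℕ} [Fact p.Prime] {O : Subring (R p)}

theorem IsValuationSubring.mem_of_mul_mem (hO : IsValuationSubring p O) {a b : R p} (ha : a ∈ O)
    (ha0 : a ≠ 0) (hab : a * b ∈ O) : b ∈ O := by
  obtain ⟨F, hF⟩ := hO
  rw [hF] at *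
  have ha0' : algebraMap (R p) (FractionRing (R p)) a ≠ 0 := by simpa using ha0
  have := F.div_mem hab ha
  rwa [map_mul, mul_div_cancel_left₀ _ ha0'] at this

theorem IsValuationSubring.exists_eq_mul (hO : IsValuationSubring p O) {a : R p} {m : ℕ}
    (ha : a ∈ O) (h : (p : R p) ^ m ∣ a) : ∃ b ∈ O, a = (p : R p) ^ m * b := by
  obtain ⟨b, rfl⟩ := h
  exact ⟨b, hO.mem_of_mul_mem (pow_mem (natCast_mem O p) m) (pow_ne_zero _ natCast_p_ne_zero) ha,
    rfl⟩

/-- Because `p^m R ∩ 𝒪 = p^m 𝒪`, approximants in `𝒪` are Cauchy for the `p`-adic topology of `𝒪`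
itself. Their limit there must be `a`, as `R` is separated. -/
theorem mem_of_forall_exists_pow_dvd_sub (hO : IsValuationSubring p O) (hc : IsPComplete p O)
    {a : R p} (h : ∀ m : ℕ, ∃ b ∈ O, (p : R p) ^ m ∣ a - b) : a ∈ O := by
  have h' : ∀ m : ℕ, ∃ b : O, (p : R p) ^ m ∣ a - O.subtype b := fun m =>
    let ⟨b, hb, hab⟩ := h m
    ⟨⟨b, hb⟩, hab⟩
  obtain ⟨b, hab⟩ := Classical.axiomOfChoice h'
  have hstep : ∀ m, (p : O) ^ m ∣ b (m + 1) - b m := by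
    intro m
    have h := dvd_sub (hab m) ((pow_dvd_pow _ (Nat.le_succ m)).trans (hab (m + 1)))
    rw [sub_sub_sub_cancel_left, ← map_sub] at h
    obtain ⟨c, hc, hbc⟩ := hO.exists_eq_mul (b (m + 1) - b m).2 h
    exact ⟨⟨c, hc⟩, Subtype.ext hbc⟩
  have := hc.toIsPrecomplete
  obtain ⟨l, hl⟩ := exists_forall_pow_dvd_sub hstep
  have hal : a = O.subtype l := by
    refine eq_of_forall_pow_dvd_sub fun m => ?_
    have h := map_dvd O.subtype (hl m)
    rw [map_pow, map_natCast, map_sub] at h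
    have h' := dvd_sub (hab m) h
    rwa [sub_sub_sub_cancel_right] at h'
  rw [hal]
  exact l.2

/-- Splits off an approximate Teichmüller digit while keeping the remainder in `𝒪`, so that
inductions on precision can run inside `𝒪`. -/
theorem IsValuationSubring.exists_eq_pow_add (hO : IsValuationSubring p O) {a : R p} (ha : a ∈ O)
    {f : ℕ} (hf : a.coeff 0 ^ p ^ f = a.coeff 0) (m : ℕ) :
    ∃ b ∈ O, a = a ^ p ^ (f * m) + p * b := by
  have hpow : a.coeff 0 ^ p ^ (f * m) = a.coeff 0 := by
    induction m with
    | zero => simp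
    | succ m ih => rw [mul_add, mul_one, pow_add, pow_mul, ih, hf]
  have h : (p : R p) ^ 1 ∣ a - a ^ p ^ (f * m) := by
    rw [pow_one, dvd_iff_coeff_zero]
    change WittVector.constantCoeff (a - a ^ p ^ (f * m)) = 0
    rw [map_sub, map_pow, sub_eq_zero]
    exact hpow.symm
  obtain ⟨b, hb, hab⟩ := hO.exists_eq_mul (sub_mem ha (pow_mem ha _)) h
  exact ⟨b, hb, by rw [← pow_one (p : R p), ← hab, add_sub_cancel]⟩

/-- Digit by digit: residues are algebraic over `𝔽_p`, so a Teichmüller digit `T` satisfies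
`φ(T^(p^(f-1))) = T^(p^f) = T`. Neither completeness nor stability of `𝒪` under `φ` is assumed. -/
theorem IsValuationSubring.exists_pow_dvd_phi_sub (hO : IsValuationSubring p O) (m : ℕ) :
    ∀ a ∈ O, ∃ b ∈ O, (p : R p) ^ m ∣ phi p b - a := by
  induction m with
  | zero => exact fun a ha => ⟨a, ha, by simp⟩
  | succ m ih =>
    intro a ha
    obtain ⟨f, hf, hx⟩ := exists_pow_eq_self (a.coeff 0)
    obtain ⟨a', ha', haa'⟩ := hO.exists_eq_pow_add ha hx m
    obtain ⟨b', hb', hbb'⟩ := ih a' ha'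
    -- The first summand approximates `T^(p^(f-1)) = φ⁻¹(T)`; the second takes care of the
    -- remainder, whose error gains a factor `p`.
    refine ⟨(a ^ p ^ (f * m)) ^ p ^ (f - 1) + p * b',
      add_mem (pow_mem (pow_mem ha _) _) (mul_mem (natCast_mem _ _) hb'), ?_⟩
    have hT := pow_dvd_pow_sub_teichmuller hf hx m
    set T := WittVector.teichmuller p (a.coeff 0)
    have h1 : (p : R p) ^ (m + 1) ∣ phi p ((a ^ p ^ (f * m)) ^ p ^ (f - 1)) - T := by
      have hTT : (phi p T) ^ p ^ (f - 1) = T := by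
        rw [phi_teichmuller, ← pow_mul, ← pow_succ', Nat.sub_add_cancel (Nat.pos_of_ne_zero hf),
          ← map_pow, hx]
      have := map_dvd (phi p) hT
      rw [map_pow, map_natCast, map_sub] at this
      rw [map_pow]
      have h2 := this.trans (sub_dvd_pow_sub_pow _ _ (p ^ (f - 1)))
      rwa [hTT] at h2
    have h3 := dvd_add (dvd_sub h1 hT) (pow_succ_dvd_mul hbb')
    convert h3 using 1
    simp only [map_add, map_mul, map_natCast]
    linear_combination (-1 : R p) * haa'

theorem IsValuationSubring.mem_of_phi_mem (hO : IsValuationSubring p O) (hc : IsPComplete p O)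
    {a : R p} (h : phi p a ∈ O) : a ∈ O := by
  refine mem_of_forall_exists_pow_dvd_sub hO hc fun m => ?_
  obtain ⟨b, hb, hab⟩ := hO.exists_pow_dvd_phi_sub m _ h
  refine ⟨b, hb, pow_dvd_of_pow_dvd_phi ?_⟩
  rw [map_sub]
  exact dvd_sub_comm.1 hab

/-- Same induction on digits: `φ^f` fixes the Teichmüller digits that occur. Completeness of `𝒪` is
not needed. -/
theorem IsValuationSubring.phi_pow_eq_self (hO : IsValuationSubring p O) {f : ℕ} (hf : f ≠ 0)
    (hres : ∀ a ∈ O, a.coeff 0 ^ p ^ f = a.coeff 0) {a : R p} (ha : a ∈ O) :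
    (phi p ^ f) a = a := by
  refine eq_of_forall_pow_dvd_sub fun m => ?_
  induction m generalizing a with
  | zero => simp
  | succ m ih =>
    obtain ⟨a', ha', haa'⟩ := hO.exists_eq_pow_add ha (hres a ha) m
    have hT := pow_dvd_pow_sub_teichmuller hf (hres a ha) m
    have hTT : (phi p ^ f) (WittVector.teichmuller p (a.coeff 0)) =
        WittVector.teichmuller p (a.coeff 0) := by
      rw [phi_pow_teichmuller, ← map_pow, hres a ha]
    set T := WittVector.teichmuller p (a.coeff 0)
    have h1 := map_dvd (phi p ^ f) hT
    rw [map_pow, map_natCast, map_sub, hTT] at h1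
    have h3 := dvd_add (dvd_sub h1 hT) (pow_succ_dvd_mul (ih ha'))
    rw [haa']
    convert h3 using 1
    simp only [map_add, map_mul, map_natCast]
    ring

theorem IsValuationSubring.evalHat_mem (hO : IsValuationSubring p O) (hc : IsPComplete p O)
    {n : ℕ} {u : GL (Fin n) (R p)} (hu : EntriesIn p O u.val) {F : CoordHat p n (R p)}
    (hF : F ∈ (pHatMap p (coordMap n O.subtype)).range) : evalHat p u F ∈ O := by
  obtain ⟨G, rfl⟩ := hF
  -- The inverse of `det u` lies in `R` and in the field cutting out `𝒪`, hence in `𝒪`.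
  obtain ⟨w, rfl⟩ : ∃ w : GL (Fin n) O, Matrix.GeneralLinearGroup.map O.subtype w = u := by
    let N : Matrix (Fin n) (Fin n) O := Matrix.of fun i j => ⟨u.val i j, hu i j⟩
    have hN : O.subtype N.det = u.val.det := by
      rw [RingHom.map_det]; rfl
    have hdet : IsUnit N.det := by
      obtain ⟨d, hd⟩ := isUnit_iff_exists_inv.1 ((Matrix.isUnit_iff_isUnit_det _).1 u.isUnit)
      rw [← hN] at hd
      have hd' : d ∈ O := hO.mem_of_mul_mem N.det.2 (left_ne_zero_of_mul_eq_one hd) (by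
        have : (N.det : R p) * d = 1 := hd
        rw [this]; exact one_mem O)
      exact isUnit_iff_exists_inv.2 ⟨⟨d, hd'⟩, Subtype.ext hd⟩
    exact ⟨Matrix.GeneralLinearGroup.mk'' N hdet, Units.ext rfl⟩
  refine mem_of_forall_exists_pow_dvd_sub hO hc fun m => ?_
  obtain ⟨c, hc⟩ := exists_evalₐ_eq_mk m G
  refine ⟨O.subtype (coordLift (RingHom.id O) w c), Subtype.property _, ?_⟩
  have h := dvd_evalHat_sub (Matrix.GeneralLinearGroup.map O.subtype w)
    (evalₐ_pHatMap (coordMap n O.subtype) m hc)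
  have key : (coordLift (RingHom.id (R p)) (Matrix.GeneralLinearGroup.map O.subtype w)).comp
      (coordMap n O.subtype) = O.subtype.comp (coordLift (RingHom.id O) w) := by
    rw [coordMap, ringHom_comp_coordLift, ringHom_comp_coordLift]
    congr 1
    · ext s; simp [coordLift_algebraMap_base]
    · exact Units.ext (coordX_map_coordLift _ _)
  have key' := congrArg (fun g => g c) key
  simp only [RingHom.comp_apply] at key'
  rwa [key'] at h

theorem entriesIn_of_isSolution (hO : IsValuationSubring p O) (hc : IsPComplete p O)
    {n : ℕ} {Δ : Matrix (Fin n) (Fin n) (CoordHat p n (R p))}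
    {α : Matrix (Fin n) (Fin n) (R p)} {u u₀ : GL (Fin n) (R p)} (hu : IsSolution p Δ α u)
    (huu₀ : MatCongr (p : R p) u.val u₀.val) (hΔ : DefinedOver p O Δ)
    (hu₀ : EntriesIn p O u₀.val) (hα : EntriesIn p O α) : EntriesIn p O u.val := by
  have key : ∀ m : ℕ, ∃ w : GL (Fin n) (R p), EntriesIn p O w.val ∧
      MatCongr ((p : R p) ^ (m + 1)) u.val w.val := by
    intro m
    induction m with
    | zero => exact ⟨u₀, hu₀, by simpa using huu₀⟩
    | succ m ih =>
      obtain ⟨w, hw, huw⟩ := ih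
      obtain ⟨v, hv, -⟩ := exists_map_phi_eq_twisted_Phi Δ α w
      refine ⟨v, fun i j => hO.mem_of_phi_mem hc ?_,
        twisted_contraction huw (isSolution_iff.1 hu) hv⟩
      have h1 : phi p (v.val i j) = _ := congrFun (congrFun hv i) j
      rw [h1, Phi_map_evalHat, Matrix.mul_apply]
      refine sum_mem fun k _ => mul_mem ?_ ?_
      · rw [Matrix.add_apply, Matrix.smul_apply, Matrix.one_apply]
        refine add_mem ?_ (nsmul_mem (hα _ _) _)
        split_ifs
        exacts [one_mem O, zero_mem O]
      · rw [Matrix.add_apply, Matrix.smul_apply]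
        exact add_mem (pow_mem (hw _ _) _) (nsmul_mem (hO.evalHat_mem hc hw (hΔ _ _)) _)
  intro i j
  refine mem_of_forall_exists_pow_dvd_sub hO hc fun m => ?_
  obtain ⟨w, hw, huw⟩ := key m
  exact ⟨_, hw i j, matCongr_of_le (Nat.le_succ m) huw i j⟩

end ValuationSubring

/-! ### Binomial series as limits of integer powers -/

section PadicPowers

/-- Only powers of a single `t` with `z = 1 + pt` are involved, so the divisibility is proved in
`ℤ[X]` and specialized. This makes it available for matrices. -/
theorem pow_dvd_one_add_pow_sub_one {S : Type} [Ring S] (p : ℕ) {z : S} (hz : (p : S) ∣ z - 1)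
    {m N : ℕ} (hN : p ^ m ∣ N) : (p : S) ^ m ∣ z ^ N - 1 := by
  obtain ⟨t, ht⟩ := hz
  obtain ⟨c, rfl⟩ := hN
  have h : (p : Polynomial ℤ) ∣ (1 + (p : Polynomial ℤ) * Polynomial.X) - 1 := ⟨Polynomial.X, by ring⟩
  have h1 := (pow_dvd_pow (p : Polynomial ℤ) (Nat.le_succ m)).trans (dvd_sub_pow_of_dvd_sub h m)
  have h2 := h1.trans (sub_dvd_pow_sub_pow _ _ c)
  have h3 := map_dvd (Polynomial.aeval t) h2
  simp only [map_pow, map_natCast, map_sub, map_add, map_mul, map_one, one_pow,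
    Polynomial.aeval_X, ← ht, ← pow_mul, add_sub_cancel] at h3
  exact h3

variable {p : ℕ} [Fact p.Prime]

theorem padicInt_pow_dvd_iff {x : ℤ_[p]} {m : ℕ} :
    (p : ℤ_[p]) ^ m ∣ x ↔ ‖x‖ ≤ (p : ℝ) ^ (-m : ℤ) := by
  rw [PadicInt.norm_le_pow_iff_mem_span_pow, Ideal.mem_span_singleton]

/-- Finitely many binomial functions are continuous on `ℤ_p`, and `ℕ` is dense there. -/
theorem exists_natCast_choose_approx (a : ℤ_[p]) (m : ℕ) :
    ∃ N : ℕ, (p : ℤ_[p]) ^ m ∣ a - N ∧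
      ∀ k < m, (p : ℤ_[p]) ^ m ∣ Ring.choose a k - (N.choose k : ℤ_[p]) := by
  have key : ∀ g : ℤ_[p] → ℤ_[p], Continuous g →
      ∀ᶠ x in nhds a, (p : ℤ_[p]) ^ m ∣ g a - g x := by
    intro g hg
    have hpos : 0 < (p : ℝ) ^ (-m : ℤ) :=
      zpow_pos (by exact_mod_cast (Fact.out : p.Prime).pos) _
    filter_upwards [hg.continuousAt.eventually (Metric.ball_mem_nhds (g a) hpos)] with x hx
    rw [padicInt_pow_dvd_iff, ← dist_eq_norm, dist_comm]
    exact (Metric.mem_ball.1 hx).le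
  have hall : ∀ᶠ x in nhds a, (p : ℤ_[p]) ^ m ∣ a - x ∧
      ∀ k ∈ Finset.range m, (p : ℤ_[p]) ^ m ∣ Ring.choose a k - Ring.choose x k :=
    (key id continuous_id).and ((Filter.eventually_all_finset _).2
      fun k _ => key _ (PadicInt.continuous_choose k))
  obtain ⟨N, hN⟩ := PadicInt.denseRange_natCast.exists_mem_open isOpen_interior
    ⟨a, mem_interior_iff_mem_nhds.2 hall⟩
  obtain ⟨h1, h2⟩ := interior_subset hN
  refine ⟨N, h1, fun k hk => ?_⟩
  have := h2 k (Finset.mem_range.2 hk)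
  rwa [Ring.choose_natCast] at this

/-- Terms of index at least `m` vanish mod `p^m`, and the remaining coefficients agree with those of
`z^N`. Properties of `z^a` can thus be read off from natural exponents, also in noncommutative
rings. -/
theorem exists_pow_approx {S : Type} [Ring S] [Algebra (R p) S] (a : ℤ_[p]) {z w : S}
    (hz : (p : S) ∣ z - 1)
    (hw : ∀ m : ℕ, ∃ N : ℕ, ∀ M ≥ N, (p : S) ^ m ∣ (∑ k ∈ Finset.range M,
      algebraMap (R p) S (ofPadicInt p (Ring.choose a k)) * (z - 1) ^ k) - w) (m : ℕ) :
    ∃ N : ℕ, (p : ℤ_[p]) ^ m ∣ a - N ∧ (p : S) ^ m ∣ w - z ^ N := by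
  have hcomm : ∀ s : S, Commute ((p : S) ^ m) s := fun s => (Nat.cast_commute p s).pow_left m
  obtain ⟨N, haN, hchoose⟩ := exists_natCast_choose_approx a m
  refine ⟨N, haN, ?_⟩
  obtain ⟨M₀, hM₀⟩ := hw m
  -- Large enough for the convergence estimate and for the whole binomial expansion of `z^N`.
  set M := max M₀ (max m (N + 1))
  have hpow : ∀ k, m ≤ k → (p : S) ^ m ∣ (z - 1) ^ k := by
    intro k hk
    obtain ⟨t, ht⟩ := hz
    rw [ht, (Nat.cast_commute p t).mul_pow]
    exact (pow_dvd_pow _ hk).mul_right _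
  have hzN : z ^ N = ∑ k ∈ Finset.range M, (N.choose k : S) * (z - 1) ^ k := by
    have h := (Commute.one_right (z - 1)).add_pow N
    rw [sub_add_cancel] at h
    rw [h]
    refine Finset.sum_subset_zero_on_sdiff (Finset.range_mono (by simp [M])) (fun k hk => ?_)
      fun k _ => ?_
    · have hk' : N < k := by
        simp only [Finset.mem_sdiff, Finset.mem_range, not_lt] at hk
        exact hk.2
      rw [Nat.choose_eq_zero_of_lt hk', Nat.cast_zero, zero_mul]
    · rw [one_pow, mul_one]
      exact (Nat.cast_commute _ _).symm.eq
  have h1 := hM₀ M (le_max_left _ _)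
  have h2 : (p : S) ^ m ∣ (∑ k ∈ Finset.range M,
      algebraMap (R p) S (ofPadicInt p (Ring.choose a k)) * (z - 1) ^ k) - z ^ N := by
    rw [hzN, ← Finset.sum_sub_distrib]
    refine Finset.dvd_sum fun k _ => ?_
    rw [← sub_mul]
    rcases lt_or_ge k m with hk | hk
    · have h := map_dvd ((algebraMap (R p) S).comp (ofPadicInt p)) (hchoose k hk)
      simp only [map_pow, map_natCast, map_sub, RingHom.comp_apply] at h
      exact h.mul_right _
    · obtain ⟨t, ht⟩ := hpow k hk
      rw [ht, ← mul_assoc, ← (hcomm _).eq, mul_assoc]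
      exact dvd_mul_right _ _
  have := dvd_sub h2 h1
  rwa [sub_sub_sub_cancel_left] at this

theorem HasPadicSum.map {p : ℕ} {A B : Type} [CommRing A] [CommRing B] (g : A →+* B) {f : ℕ → A} {s : A}
    (h : HasPadicSum p f s) : HasPadicSum p (fun k => g (f k)) (g s) := by
  intro m
  obtain ⟨N, hN⟩ := h m
  refine ⟨N, fun M hM => ?_⟩
  simpa using map_dvd g (hN M hM)

theorem HasPadicSum.unique {f : ℕ → R p} {s t : R p} (hs : HasPadicSum p f s)
    (ht : HasPadicSum p f t) : s = t := by
  refine eq_of_forall_pow_dvd_sub fun m => ?_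
  obtain ⟨N, hN⟩ := hs m
  obtain ⟨N', hN'⟩ := ht m
  have := dvd_sub (hN' _ (le_max_right N N')) (hN _ (le_max_left N N'))
  rwa [sub_sub_sub_cancel_left] at this

theorem phi_ofPadicInt (c : ℤ_[p]) : phi p (ofPadicInt p c) = ofPadicInt p c := by
  have h : ∀ x : WittVector p (ZMod p),
      phi p (WittVector.map (algebraMap (ZMod p) (AlgebraicClosure (ZMod p))) x) =
        WittVector.map (algebraMap (ZMod p) (AlgebraicClosure (ZMod p))) x := by
    intro x
    ext k
    rw [phi, WittVector.coeff_frobenius_charP, WittVector.map_coeff, ← map_pow, ZMod.pow_card]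
  exact h _

theorem IsPadicPow.phi {a : ℤ_[p]} {z w : R p} (h : IsPadicPow p a z w) :
    IsPadicPow p a (phi p z) (phi p w) := by
  have := HasPadicSum.map (DeltaLinear.phi p) h
  simpa [IsPadicPow, phi_ofPadicInt] using this

theorem IsPadicPow.phi_pow {a : ℤ_[p]} {z w : R p} (h : IsPadicPow p a z w) (f : ℕ) :
    IsPadicPow p a ((DeltaLinear.phi p ^ f) z) ((DeltaLinear.phi p ^ f) w) := by
  induction f with
  | zero => simpa
  | succ f ih => simpa [pow_succ', RingHom.mul_def] using ih.phi

theorem IsPadicPow.evalHat {n : ℕ} {a : ℤ_[p]} {z w : CoordHat p n (R p)} (h : IsPadicPow p a z w)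
    (u : GL (Fin n) (R p)) :
    IsPadicPow p a (evalHat p u z) (DeltaLinear.evalHat p u w) := by
  have := HasPadicSum.map (DeltaLinear.evalHat p u) h
  simpa [IsPadicPow, evalHat_algebraMap] using this

/-- With `N` close to `-1/n`, `w^n z` is close to `z^(Nn+1)`, and `p^m ∣ Nn + 1` makes the latter
close to `1`. -/
theorem IsPadicPow.pow_mul_eq_one {n : ℕ} (hn : ¬ p ∣ n) {z w : R p} (hz : (p : R p) ∣ z - 1)
    (h : IsPadicPow p (-Ring.inverse (n : ℤ_[p])) z w) : w ^ n * z = 1 := by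
  have hunit : IsUnit (n : ℤ_[p]) := by
    rw [PadicInt.isUnit_iff, PadicInt.norm_natCast_eq_one_iff]
    exact (Nat.Prime.coprime_iff_not_dvd Fact.out).2 hn
  refine eq_of_forall_pow_dvd_sub fun m => ?_
  obtain ⟨N, hN, hw⟩ := exists_pow_approx _ hz h m
  have hdvd : p ^ m ∣ N * n + 1 := by
    have h1 := hN.mul_right (n : ℤ_[p])
    rw [sub_mul, neg_mul, Ring.inverse_mul_cancel _ hunit] at h1
    have h2 : (p : ℤ_[p]) ^ m ∣ ((N * n + 1 : ℕ) : ℤ) := by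
      rw [← dvd_neg]
      convert h1 using 1
      push_cast
      ring
    rw [PadicInt.pow_p_dvd_int_iff] at h2
    exact_mod_cast h2
  have h3 := pow_dvd_one_add_pow_sub_one p hz hdvd
  have h4 := (hw.trans (sub_dvd_pow_sub_pow _ _ n)).mul_right z
  rw [← pow_mul, sub_mul, ← pow_succ] at h4
  have := dvd_add h4 h3
  rwa [sub_add_sub_cancel] at this

end PadicPowers

/-! ### Square roots of matrices congruent to `1` -/

section MatrixPowers

variable {p : ℕ} [Fact p.Prime] {n : ℕ}

theorem natCast_pow_dvd_matrix_iff {m : ℕ} {M : Matrix (Fin n) (Fin n) (R p)} :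
    (p : Matrix (Fin n) (Fin n) (R p)) ^ m ∣ M ↔ ∀ i j, (p : R p) ^ m ∣ M i j := by
  have hp : ∀ N : Matrix (Fin n) (Fin n) (R p),
      (p : Matrix (Fin n) (Fin n) (R p)) ^ m * N = (p : R p) ^ m • N := by
    intro N
    rw [← Nat.cast_pow, ← Nat.cast_pow, ← nsmul_eq_mul, Nat.cast_smul_eq_nsmul]
  constructor
  · rintro ⟨N, rfl⟩ i j
    rw [hp]
    exact dvd_mul_right _ _
  · intro h
    choose N hN using h
    exact ⟨Matrix.of N, by rw [hp]; ext1 i j; exact hN i j⟩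

theorem natCast_pow_dvd_sub_iff_matCongr {m : ℕ} {M N : Matrix (Fin n) (Fin n) (R p)} :
    (p : Matrix (Fin n) (Fin n) (R p)) ^ m ∣ M - N ↔ MatCongr ((p : R p) ^ m) M N :=
  natCast_pow_dvd_matrix_iff

theorem IsPadicMatrixPow.evalHat {a : ℤ_[p]} {Z W : Matrix (Fin n) (Fin n) (CoordHat p n (R p))}
    (h : IsPadicMatrixPow p a Z W) (u : GL (Fin n) (R p)) :
    IsPadicMatrixPow p a (Z.map (evalHat p u)) (W.map (DeltaLinear.evalHat p u)) := by
  intro i j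
  have := HasPadicSum.map (DeltaLinear.evalHat p u) (h i j)
  have hpow : ∀ k : ℕ, ((Z.map (DeltaLinear.evalHat p u) - 1) ^ k) i j =
      DeltaLinear.evalHat p u (((Z - 1) ^ k) i j) := by
    intro k
    have h : (Z.map (DeltaLinear.evalHat p u) - 1) =
        (DeltaLinear.evalHat p u).mapMatrix (Z - 1) := by
      rw [map_sub, map_one, RingHom.mapMatrix_apply]
    rw [h, ← map_pow]
    rfl
  simpa [evalHat_algebraMap, hpow] using this

theorem IsPadicMatrixPow.exists_pow_approx {a : ℤ_[p]} {Z W : Matrix (Fin n) (Fin n) (R p)}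
    (h : IsPadicMatrixPow p a Z W) (hZ : MatCongr (p : R p) Z 1) (m : ℕ) :
    ∃ N : ℕ, (p : ℤ_[p]) ^ m ∣ a - N ∧ MatCongr ((p : R p) ^ m) W (Z ^ N) := by
  have hZ' : (p : Matrix (Fin n) (Fin n) (R p)) ∣ Z - 1 := by
    rw [← pow_one (p : Matrix (Fin n) (Fin n) (R p)), natCast_pow_dvd_sub_iff_matCongr, pow_one]
    exact hZ
  simp only [← natCast_pow_dvd_sub_iff_matCongr]
  refine DeltaLinear.exists_pow_approx a hZ' (fun m => ?_) m
  choose N hN using fun i j => h i j m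
  -- The sum of the entrywise thresholds serves as a common upper bound.
  refine ⟨∑ i, ∑ j, N i j, fun M hM => ?_⟩
  rw [natCast_pow_dvd_matrix_iff]
  intro i j
  have hij : N i j ≤ M := by
    refine le_trans ?_ hM
    exact (Finset.single_le_sum (f := fun j => N i j) (fun _ _ => Nat.zero_le _)
      (Finset.mem_univ j)).trans (Finset.single_le_sum (f := fun i => ∑ j, N i j)
        (fun _ _ => Nat.zero_le _) (Finset.mem_univ i))
  convert hN i j M hij using 1
  rw [Matrix.sub_apply, Matrix.sum_apply]
  congr 1
  refine Finset.sum_congr rfl fun k _ => ?_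
  rw [Matrix.algebraMap_eq_diagonal]
  simp

theorem IsPadicMatrixPow.mul_self (hp : p ≠ 2) {Z W : Matrix (Fin n) (Fin n) (R p)}
    (h : IsPadicMatrixPow p (Ring.inverse (2 : ℤ_[p])) Z W) (hZ : MatCongr (p : R p) Z 1) :
    W * W = Z := by
  have hunit : IsUnit (2 : ℤ_[p]) := by
    rw [← Nat.cast_ofNat, PadicInt.isUnit_iff, PadicInt.norm_natCast_eq_one_iff]
    exact (Nat.coprime_primes Fact.out Nat.prime_two).2 hp
  refine eq_of_forall_matCongr fun m => ?_
  obtain ⟨N, hN, hW⟩ := h.exists_pow_approx hZ (m + 1)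
  have hdvd : (p : ℤ) ^ (m + 1) ∣ 2 * N - 1 := by
    have h1 := hN.mul_right (2 : ℤ_[p])
    rw [sub_mul, Ring.inverse_mul_cancel _ hunit] at h1
    have h2 : (p : ℤ_[p]) ^ (m + 1) ∣ ((2 * N - 1 : ℤ) : ℤ_[p]) := by
      rw [← dvd_neg]
      convert h1 using 1
      push_cast
      ring
    rw [PadicInt.pow_p_dvd_int_iff] at h2
    exact_mod_cast h2
  -- Writing `N = k + 1` makes `2N - 1 = 2k + 1` a natural exponent, so that `Z^(2N) = Z^(2k+1) Z`
  -- with the first factor close to `1`.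
  have hN0 : N ≠ 0 := by
    rintro rfl
    have : (p : ℤ) ∣ 1 := by
      have := (dvd_pow_self (p : ℤ) (Nat.succ_ne_zero m)).trans hdvd
      simpa using this
    exact (Fact.out : p.Prime).one_lt.ne' (by exact_mod_cast Int.eq_one_of_dvd_one (by simp) this)
  obtain ⟨k, rfl⟩ := Nat.exists_eq_succ_of_ne_zero hN0
  have hdvd' : p ^ (m + 1) ∣ 2 * k + 1 := by
    have : ((p ^ (m + 1) : ℕ) : ℤ) ∣ ((2 * k + 1 : ℕ) : ℤ) := by
      convert hdvd using 1
      · push_cast; rfl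
      · push_cast; ring
    exact_mod_cast this
  have hZ' : (p : Matrix (Fin n) (Fin n) (R p)) ∣ Z - 1 := by
    rw [← pow_one (p : Matrix (Fin n) (Fin n) (R p)), natCast_pow_dvd_sub_iff_matCongr, pow_one]
    exact hZ
  have h1 := natCast_pow_dvd_sub_iff_matCongr.1 (pow_dvd_one_add_pow_sub_one p hZ' hdvd')
  have e : Z ^ (k + 1) * Z ^ (k + 1) = Z ^ (2 * k + 1) * Z := by
    rw [← pow_succ, ← pow_add]
    congr 1
    omega
  have h2 := h1.mul (MatCongr.refl _ Z)
  rw [← e, one_mul] at h2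
  exact (hW.mul hW).trans h2

/-- Self-adjointness with respect to `A` passes from `Z` to its powers and then to their limit `W`.
-/
theorem IsPadicMatrixPow.transpose_mul {a : ℤ_[p]} {Z W A : Matrix (Fin n) (Fin n) (R p)}
    (h : IsPadicMatrixPow p a Z W) (hZ : MatCongr (p : R p) Z 1) (hA : Zᵀ * A = A * Z) :
    Wᵀ * A = A * W := by
  refine eq_of_forall_matCongr fun m => ?_
  obtain ⟨N, -, hW⟩ := h.exists_pow_approx hZ (m + 1)
  have h1 : (Z ^ N)ᵀ * A = A * Z ^ N := by
    rw [Matrix.transpose_pow]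
    exact ((SemiconjBy.pow_right (a := A) (x := Z) (y := Zᵀ) hA.symm N).eq).symm
  have h2 := hW.transpose.mul (MatCongr.refl _ A)
  rw [h1] at h2
  exact h2.trans ((MatCongr.refl _ A).mul hW.symm)

end MatrixPowers

/-! ### Type `SL_n` -/

section SpecialLinear

variable {p : ℕ} [Fact p.Prime] {n : ℕ}

theorem IsTypeSL.exists_scalar {Δ : Matrix (Fin n) (Fin n) (CoordHat p n (R p))}
    (h : IsTypeSL p Δ) (u : GL (Fin n) (R p)) :
    ∃ z w : R p, z * u.val.det ^ p = (frobPow p u.val).det ∧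
      IsPadicPow p (-Ring.inverse (n : ℤ_[p])) z w ∧ w ^ n * z = 1 ∧
      (Phi p Δ).map (evalHat p u) = w • frobPow p u.val := by
  obtain ⟨hn, lam, hlam, hΔ⟩ := h
  have hX : (evalHat p u) (X p n).det = u.val.det := by
    rw [RingHom.map_det, RingHom.mapMatrix_apply, X_map_evalHat]
  have hXp : (evalHat p u) (frobPow p (X p n)).det = (frobPow p u.val).det := by
    rw [RingHom.map_det, RingHom.mapMatrix_apply, frobPow_map, X_map_evalHat]
  have hunit : IsUnit ((X p n).det ^ p) := by
    refine IsUnit.pow _ ?_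
    rw [X, ← RingHom.mapMatrix_apply, ← RingHom.map_det]
    exact ((Matrix.isUnit_iff_isUnit_det _).1 (isUnit_coordX n (R p))).map _
  have hz : evalHat p u ((frobPow p (X p n)).det * Ring.inverse ((X p n).det ^ p)) *
      u.val.det ^ p = (frobPow p u.val).det := by
    rw [← hX, ← map_pow, ← map_mul, mul_assoc, Ring.inverse_mul_cancel _ hunit, mul_one, hXp]
  set z := evalHat p u ((frobPow p (X p n)).det * Ring.inverse ((X p n).det ^ p))
  have hdet : IsUnit (u.val.det ^ p) := ((Matrix.isUnit_iff_isUnit_det _).1 u.isUnit).pow p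
  -- The determinant commutes with Frobenius mod `p`, and `det(u)^p` is a unit.
  have hz1 : (p : R p) ∣ z - 1 := by
    have h1 := dvd_det_frobPow_sub p u.val
    rw [← hz] at h1
    refine (hdet.dvd_mul_right (a := (p : R p))).1 ?_
    rwa [sub_mul, one_mul]
  have hw := hlam.evalHat u
  refine ⟨z, evalHat p u lam, hz, hw, hw.pow_mul_eq_one hn hz1, ?_⟩
  rw [Phi, hΔ, sub_smul, one_smul, add_sub_cancel, ← X_map_evalHat u, ← frobPow_map]
  refine Matrix.ext fun i j => ?_
  simp only [Matrix.map_apply, Matrix.smul_apply, smul_eq_mul, map_mul]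

theorem det_eq_one_of_isSolution {Δ : Matrix (Fin n) (Fin n) (CoordHat p n (R p))}
    {α : Matrix (Fin n) (Fin n) (R p)} {u u₀ : GL (Fin n) (R p)} (hu : IsSolution p Δ α u)
    (huu₀ : MatCongr (p : R p) u.val u₀.val) (hΔ : IsTypeSL p Δ) (hu₀ : u₀.val.det = 1)
    (hα : (1 + p • α).det = 1) : u.val.det = 1 := by
  obtain ⟨z, w, hz, -, hwz, hPhi⟩ := hΔ.exists_scalar u
  have h := congrArg Matrix.det (isSolution_iff.1 hu)
  rw [Matrix.det_mul, hα, one_mul, hPhi, Matrix.det_smul, Fintype.card_fin, ← hz, ← mul_assoc, hwz,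
    one_mul, ← RingHom.mapMatrix_apply, ← RingHom.map_det] at h
  refine eq_of_phi_eq_pow h (by simp) ?_
  rw [← hu₀]
  exact huu₀.det

end SpecialLinear

/-! ### Type `SO(q)` -/

section ClassicalForms

/-- A matrix `q` with `qᵗ = ε q`, `q² = ε` and entries among `0`, `1`, `-1`. -/
def IsSignedInvolution {ι A : Type} [Fintype ι] [DecidableEq ι] [CommRing A] (ε : A)
    (q : Matrix ι ι A) : Prop :=
  qᵀ = ε • q ∧ q * q = ε • 1 ∧ ∀ i j, q i j = 0 ∨ q i j = 1 ∨ q i j = -1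

theorem IsSignedInvolution.reindex {ι κ A : Type} [Fintype ι] [DecidableEq ι] [Fintype κ]
    [DecidableEq κ] [CommRing A] {ε : A} {q : Matrix ι ι A} (h : IsSignedInvolution ε q)
    (e : ι ≃ κ) : IsSignedInvolution ε (Matrix.reindex e e q) := by
  obtain ⟨h1, h2, h3⟩ := h
  refine ⟨?_, ?_, fun i j => h3 _ _⟩
  · rw [Matrix.transpose_reindex, h1]; rfl
  · rw [Matrix.reindex_apply, Matrix.submatrix_mul_equiv, h2]
    ext i j
    simp [Matrix.one_apply]

theorem isSignedInvolution_fromBlocks (r : ℕ) (A : Type) [CommRing A] {ε : A} (hε : ε = 1 ∨ ε = -1) :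
    IsSignedInvolution ε
      (Matrix.fromBlocks (0 : Matrix (Fin r) (Fin r) A) 1 (ε • 1) (0 : Matrix (Fin r) (Fin r) A)) := by
  have hεε : ε * ε = 1 := by rcases hε with rfl | rfl <;> simp
  refine ⟨?_, ?_, ?_⟩
  · rw [Matrix.fromBlocks_transpose, Matrix.fromBlocks_smul]
    simp [smul_smul, hεε]
  · rw [Matrix.fromBlocks_multiply, ← Matrix.fromBlocks_one, Matrix.fromBlocks_smul]
    simp
  · rintro (i | i) (j | j)
    · simp
    · rw [Matrix.fromBlocks_apply₁₂, Matrix.one_apply]; split_ifs <;> simp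
    · rw [Matrix.fromBlocks_apply₂₁, Matrix.smul_apply, Matrix.one_apply]
      rcases hε with rfl | rfl <;> split_ifs <;> simp
    · simp

/-- Collects what the argument needs, uniformly in the three families: symmetry up to sign,
invertibility, and entries preserved by `φ` and by odd powers. -/
theorem IsClassicalForm.exists_isSignedInvolution {A : Type} [CommRing A] {n : ℕ}
    {q : Matrix (Fin n) (Fin n) A} (h : IsClassicalForm q) :
    ∃ ε : A, (ε = 1 ∨ ε = -1) ∧ IsSignedInvolution ε q := by
  cases h with
  | symplectic r =>
    refine ⟨-1, Or.inr rfl, ?_⟩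
    have := (isSignedInvolution_fromBlocks r A (ε := -1) (Or.inr rfl)).reindex finSumFinEquiv
    rwa [neg_one_smul] at this
  | evenOrthogonal r =>
    refine ⟨1, Or.inl rfl, ?_⟩
    have := (isSignedInvolution_fromBlocks r A (ε := 1) (Or.inl rfl)).reindex finSumFinEquiv
    rwa [one_smul] at this
  | oddOrthogonal r =>
    refine ⟨1, Or.inl rfl, ?_⟩
    refine IsSignedInvolution.reindex ?_ _
    have := (isSignedInvolution_fromBlocks r A (ε := 1) (Or.inl rfl)).reindex finSumFinEquiv
    rw [one_smul] at this
    obtain ⟨h1, h2, h3⟩ := this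
    refine ⟨?_, ?_, ?_⟩
    · rw [Matrix.fromBlocks_transpose, h1]; simp
    · rw [Matrix.fromBlocks_multiply, h2, ← Matrix.fromBlocks_one, Matrix.fromBlocks_smul]
      simp
    · rintro (i | i) (j | j)
      · rw [Matrix.fromBlocks_apply₁₁, Matrix.one_apply]; split_ifs <;> simp
      · simp
      · simp
      · exact h3 i j

end ClassicalForms

section Orthogonal

variable {p : ℕ} [Fact p.Prime] {n : ℕ}

/-- It is congruent mod `p` to the unit `det(x)^p`, and `p` lies in the Jacobson radical of the
completion. This makes the matrix inverse in `IsTypeSO` a genuine inverse. -/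
theorem isUnit_det_frobPow_X : IsUnit (frobPow p (X p n)).det := by
  have hunit : IsUnit ((X p n).det ^ p) := by
    refine IsUnit.pow _ ?_
    rw [X, ← RingHom.mapMatrix_apply, ← RingHom.map_det]
    exact ((Matrix.isUnit_iff_isUnit_det _).1 (isUnit_coordX n (R p))).map _
  have hfg : (Ideal.span {(p : Coord n (R p))}).FG := ⟨{(p : Coord n (R p))}, by simp⟩
  have hcomplete := AdicCompletion.isAdicComplete_self (Ideal.span {(p : Coord n (R p))}) hfg
  have hjac := IsAdicComplete.le_jacobson_bot ((Ideal.span {(p : Coord n (R p))}).map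
    (algebraMap (Coord n (R p)) (CoordHat p n (R p))))
  have hp : (p : CoordHat p n (R p)) ∈ (⊥ : Ideal (CoordHat p n (R p))).jacobson := by
    refine hjac ?_
    rw [← map_natCast (algebraMap (Coord n (R p)) (CoordHat p n (R p))) p]
    exact Ideal.mem_map_of_mem _ (Ideal.mem_span_singleton_self _)
  obtain ⟨y, hy⟩ := dvd_det_frobPow_sub p (X p n)
  obtain ⟨v, hv⟩ := hunit
  have h1 := Ideal.mem_jacobson_bot.1 hp (y * ↑v⁻¹)
  have h2 : (frobPow p (X p n)).det = (p * (y * ↑v⁻¹) + 1) * v := by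
    rw [add_mul, mul_assoc, mul_assoc, Units.inv_mul, mul_one, one_mul, ← hy, hv, sub_add_cancel]
  rw [h2]
  exact h1.mul v.isUnit

theorem frobPow_eq_self_of_entries (hp : p ≠ 2) {q : Matrix (Fin n) (Fin n) (R p)}
    (h : ∀ i j, q i j = 0 ∨ q i j = 1 ∨ q i j = -1) : frobPow p q = q := by
  refine Matrix.ext fun i j => ?_
  have hp0 : p ≠ 0 := (Fact.out : p.Prime).ne_zero
  have hodd : Odd p := (Fact.out : p.Prime).odd_of_ne_two hp
  change q i j ^ p = q i j
  rcases h i j with h | h | h <;> rw [h]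
  · exact zero_pow hp0
  · exact one_pow p
  · exact hodd.neg_one_pow

theorem map_phi_eq_self_of_entries {q : Matrix (Fin n) (Fin n) (R p)}
    (h : ∀ i j, q i j = 0 ∨ q i j = 1 ∨ q i j = -1) : q.map (phi p) = q := by
  refine Matrix.ext fun i j => ?_
  change phi p (q i j) = q i j
  rcases h i j with h | h | h <;> rw [h] <;> simp

theorem frobPow_smul_of_sign (hp : p ≠ 2) {ε : R p} (hε : ε = 1 ∨ ε = -1)
    (M : Matrix (Fin n) (Fin n) (R p)) : frobPow p (ε • M) = ε • frobPow p M := by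
  have hodd : Odd p := (Fact.out : p.Prime).odd_of_ne_two hp
  refine Matrix.ext fun i j => ?_
  change (ε * M i j) ^ p = ε * M i j ^ p
  rcases hε with rfl | rfl
  · simp
  · rw [mul_pow, hodd.neg_one_pow]

/-- With `A = (u^(p))ᵗ q u^(p)`, `AZ = B = (uᵗqu)^(p)` and `W² = Z`, one has `Φ(u) = u^(p) W`. The
form becomes `WᵗAW = AW² = B`, provided `WᵗA = AW`. -/
theorem IsTypeSO.Phi_form (hp : p ≠ 2) {q : Matrix (Fin n) (Fin n) (R p)}
    (hq : IsClassicalForm q) {Δ : Matrix (Fin n) (Fin n) (CoordHat p n (R p))}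
    (h : IsTypeSO p q Δ) (u : GL (Fin n) (R p)) :
    ((Phi p Δ).map (evalHat p u))ᵀ * q * (Phi p Δ).map (evalHat p u) =
      frobPow p (u.valᵀ * q * u.val) := by
  obtain ⟨ε, hε, hqt, hqq, hent⟩ := hq.exists_isSignedInvolution
  obtain ⟨Lam, hLam, hΔ⟩ := h
  have hεu : IsUnit ε := by rcases hε with rfl | rfl <;> simp
  have hqu : IsUnit q.det := by
    refine isUnit_of_mul_isUnit_left (y := q.det) ?_
    rw [← Matrix.det_mul, hqq, Matrix.det_smul, Matrix.det_one, mul_one]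
    exact hεu.pow _
  have hmapA : (((frobPow p (X p n))ᵀ * const p q * frobPow p (X p n))).map (evalHat p u) =
      (frobPow p u.val)ᵀ * q * frobPow p u.val := by
    rw [Matrix.map_mul, Matrix.map_mul, const_map_evalHat, Matrix.transpose_map, frobPow_map,
      X_map_evalHat]
  have hmapB : (frobPow p ((X p n)ᵀ * const p q * X p n)).map (evalHat p u) =
      frobPow p (u.valᵀ * q * u.val) := by
    rw [frobPow_map, Matrix.map_mul, Matrix.map_mul, const_map_evalHat, Matrix.transpose_map,
      X_map_evalHat]
  have hAunit : IsUnit ((frobPow p (X p n))ᵀ * const p q * frobPow p (X p n)).det := by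
    rw [Matrix.det_mul, Matrix.det_mul, Matrix.det_transpose]
    refine (isUnit_det_frobPow_X.mul ?_).mul isUnit_det_frobPow_X
    rw [const, ← RingHom.mapMatrix_apply, ← RingHom.map_det]
    exact hqu.map _
  have hAunit' := hAunit.map (evalHat p u)
  rw [RingHom.map_det, RingHom.mapMatrix_apply, hmapA] at hAunit'
  have hW := hLam.evalHat u
  set Z := (((frobPow p (X p n))ᵀ * const p q * frobPow p (X p n))⁻¹ *
        frobPow p ((X p n)ᵀ * const p q * X p n)).map (evalHat p u)
  set W := Lam.map (evalHat p u)
  set A := (frobPow p u.val)ᵀ * q * frobPow p u.val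
  set B := frobPow p (u.valᵀ * q * u.val) with hB
  have hZ : A * Z = B := by
    rw [← hmapA, ← hmapB, ← Matrix.map_mul, Matrix.mul_nonsing_inv_cancel_left _ _ hAunit]
  have hZ1 : MatCongr (p : R p) Z 1 := by
    have hBA : MatCongr (p : R p) B A := by
      have h1 := frobPow_mul_congr p (u.valᵀ * q) u.val
      have h2 := (frobPow_mul_congr p u.valᵀ q).mul (MatCongr.refl _ (frobPow p u.val))
      have := h1.trans h2
      rwa [frobPow_transpose, frobPow_eq_self_of_entries hp hent] at this
    have h3 := (MatCongr.refl _ A⁻¹).mul hBA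
    rwa [← hZ, Matrix.nonsing_inv_mul_cancel_left _ _ hAunit', Matrix.nonsing_inv_mul _ hAunit']
      at h3
  have hAt : Aᵀ = ε • A := by
    simp only [A, Matrix.transpose_mul, Matrix.transpose_transpose, hqt, Matrix.smul_mul,
      Matrix.mul_smul, Matrix.mul_assoc]
  have hBt : Bᵀ = ε • B := by
    rw [hB, ← frobPow_transpose, ← frobPow_smul_of_sign hp hε]
    simp only [Matrix.transpose_mul, Matrix.transpose_transpose, hqt, Matrix.smul_mul,
      Matrix.mul_smul, Matrix.mul_assoc]
  -- Transpose `AZ = B`: both `A` and `B` acquire the same sign `ε`, which cancels.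
  have hZA : Zᵀ * A = A * Z := by
    have h1 := congrArg Matrix.transpose hZ
    rw [Matrix.transpose_mul, hAt, hBt, Matrix.mul_smul] at h1
    rw [hZ]
    obtain ⟨e, he⟩ := hεu.exists_left_inv
    simpa [smul_smul, he] using congrArg (fun M => e • M) h1
  have hPhi : (Phi p Δ).map (evalHat p u) = frobPow p u.val * W := by
    rw [Phi, hΔ, mul_sub, mul_one, add_sub_cancel, Matrix.map_mul, frobPow_map, X_map_evalHat]
  rw [hPhi, Matrix.transpose_mul]
  calc Wᵀ * (frobPow p u.val)ᵀ * q * (frobPow p u.val * W) = Wᵀ * A * W := by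
        simp only [A, Matrix.mul_assoc]
    _ = B := by
        rw [hW.transpose_mul hZ1 hZA, Matrix.mul_assoc, hW.mul_self hp hZ1, hZ]

theorem mem_SOq_of_isSolution (hp : p ≠ 2) {q : Matrix (Fin n) (Fin n) (R p)}
    (hq : IsClassicalForm q) {Δ : Matrix (Fin n) (Fin n) (CoordHat p n (R p))}
    (hΔ : IsTypeSO p q Δ) {α : Matrix (Fin n) (Fin n) (R p)} {u u₀ : GL (Fin n) (R p)}
    (hu : IsSolution p Δ α u) (huu₀ : MatCongr (p : R p) u.val u₀.val) (hu₀ : u₀.val ∈ SOq q)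
    (hα : 1 + p • α ∈ SOq q) : u.val ∈ SOq q := by
  obtain ⟨ε, hε, hqt, hqq, hent⟩ := hq.exists_isSignedInvolution
  have hphi : (u.valᵀ * q * u.val).map (phi p) = frobPow p (u.valᵀ * q * u.val) := by
    rw [← hΔ.Phi_form hp hq u, Matrix.map_mul, Matrix.map_mul, map_phi_eq_self_of_entries hent,
      Matrix.transpose_map, isSolution_iff.1 hu, Matrix.transpose_mul]
    have h := congrArg (fun M => ((Phi p Δ).map (evalHat p u))ᵀ * M * (Phi p Δ).map (evalHat p u))
      hα.1
    simpa only [Matrix.mul_assoc] using h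
  have hform : u.valᵀ * q * u.val = q := by
    refine Matrix.ext fun i j => eq_of_phi_eq_pow (congrFun (congrFun hphi i) j) ?_ ?_
    · exact (congrFun (congrFun (map_phi_eq_self_of_entries hent) i) j).trans
        (congrFun (congrFun (frobPow_eq_self_of_entries hp hent) i) j).symm
    · have := (huu₀.transpose.mul (MatCongr.refl _ q)).mul huu₀
      rw [hu₀.1] at this
      exact this i j
  refine ⟨hform, ?_⟩
  have hqu : IsUnit q.det := by
    refine isUnit_of_mul_isUnit_left (y := q.det) ?_
    rw [← Matrix.det_mul, hqq, Matrix.det_smul, Matrix.det_one, mul_one]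
    exact IsUnit.pow _ (by rcases hε with rfl | rfl <;> simp)
  have hsq : u.val.det * u.val.det = 1 := by
    have h := congrArg Matrix.det hform
    rw [Matrix.det_mul, Matrix.det_mul, Matrix.det_transpose] at h
    exact hqu.mul_left_cancel (by linear_combination h)
  have hdet : (p : R p) ∣ u.val.det - 1 := by
    have := huu₀.det
    rwa [hu₀.2] at this
  rcases mul_self_eq_one_iff.1 hsq with h | h
  · exact h
  · exfalso
    rw [h] at hdet
    obtain ⟨k, hk⟩ := (Fact.out : p.Prime).odd_of_ne_two hp
    -- With `p = 2k + 1` this combination equals `1`, so `det u = -1` is impossible.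
    have h1 : (p : R p) ∣ p + k * (-1 - 1) := dvd_add dvd_rfl (hdet.mul_left _)
    have hk' : (p : R p) = 2 * (k : R p) + 1 := by
      exact_mod_cast congrArg (Nat.cast : ℕ → R p) hk
    rw [show (p : R p) + k * (-1 - 1) = 1 by linear_combination hk'] at h1
    exact not_isUnit_natCast_p (isUnit_of_dvd_one h1)

end Orthogonal

/-! ### Differentials of Frobenius iterates -/

noncomputable section

section Iteration

variable {A B : Type} [CommRing A] [CommRing B] {n : ℕ}

/-- The iterates of the maps `v ↦ M i * v^(p)`, starting from `u`. -/
def frobIter (p : ℕ) (M : ℕ → Matrix (Fin n) (Fin n) A) (u : Matrix (Fin n) (Fin n) A) :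
    ℕ → Matrix (Fin n) (Fin n) A
  | 0 => u
  | i + 1 => M i * frobPow p (frobIter p M u i)

theorem frobIter_map (p : ℕ) (g : A →+* B) (M : ℕ → Matrix (Fin n) (Fin n) A)
    (u : Matrix (Fin n) (Fin n) A) (i : ℕ) :
    (frobIter p M u i).map g = frobIter p (fun i => (M i).map g) (u.map g) i := by
  induction i with
  | zero => rfl
  | succ i ih => rw [frobIter, frobIter, Matrix.map_mul, frobPow_map, ih]

end Iteration

section Derivations

variable {C M : Type} [CommRing C] [AddCommGroup M] [Module C M] {n p : ℕ}

/-- The subring of elements whose differential lies in a given submodule. -/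
def differentialSubring (d : Derivation ℤ C M) (N : Submodule C M) : Subring C where
  carrier := {c | d c ∈ N}
  mul_mem' {a b} ha hb := by
    change d (a * b) ∈ N
    rw [d.leibniz]
    exact N.add_mem (N.smul_mem _ hb) (N.smul_mem _ ha)
  one_mem' := by
    change d 1 ∈ N
    rw [d.map_one_eq_zero]
    exact N.zero_mem
  add_mem' {a b} ha hb := by
    change d (a + b) ∈ N
    rw [map_add]
    exact N.add_mem ha hb
  zero_mem' := by
    change d 0 ∈ N
    rw [map_zero]
    exact N.zero_mem
  neg_mem' {a} ha := by
    change d (-a) ∈ N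
    rw [map_neg]
    exact N.neg_mem ha

/-- Since `d(c^p) = p c^(p-1) dc` and the matrices are constants for `d`, a single step already
lands in `pN`; later steps stay there. -/
theorem derivation_frobIter_mem (d : Derivation ℤ C M) (N : Submodule C M)
    {A : ℕ → Matrix (Fin n) (Fin n) C} (hA : ∀ i j k, d (A i j k) = 0)
    {u : Matrix (Fin n) (Fin n) C} (hu : ∀ j k, d (u j k) ∈ N) (i : ℕ) (j k : Fin n) :
    d (frobIter p A u (i + 1) j k) ∈ Ideal.span {(p : C)} • N := by
  have hN : ∀ i j k, d (frobIter p A u i j k) ∈ N →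
      d ((frobPow p (frobIter p A u i)) j k) ∈ Ideal.span {(p : C)} • N := by
    intro i j k h
    change d (frobIter p A u i j k ^ p) ∈ _
    rw [d.leibniz_pow, ← Nat.cast_smul_eq_nsmul C]
    exact Submodule.smul_mem_smul (Ideal.mem_span_singleton_self _) (N.smul_mem _ h)
  induction i generalizing j k with
  | zero =>
    rw [frobIter, Matrix.mul_apply, map_sum]
    refine Submodule.sum_mem _ fun l _ => ?_
    rw [d.leibniz, hA, smul_zero, add_zero]
    exact Submodule.smul_mem _ _ (hN 0 _ _ (hu _ _))
  | succ i ih =>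
    rw [frobIter, Matrix.mul_apply, map_sum]
    refine Submodule.sum_mem _ fun l _ => ?_
    rw [d.leibniz, hA, smul_zero, add_zero]
    exact Submodule.smul_mem _ _ (hN (i + 1) _ _ (Submodule.smul_le_right (ih _ _)))

theorem derivation_det_mem (d : Derivation ℤ C M) (N : Submodule C M)
    {u : Matrix (Fin n) (Fin n) C} (hu : ∀ j k, d (u j k) ∈ N) : d u.det ∈ N := by
  change u.det ∈ differentialSubring d N
  rw [Matrix.det_apply]
  refine Subring.sum_mem _ fun σ _ => ?_
  rw [Units.smul_def]
  exact zsmul_mem (Subring.prod_mem (differentialSubring d N) fun i _ => hu _ _) _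

/-- Nakayama: the span `N` of all `d(u j k)` and `dμ` is finitely generated and contained in `pN`,
with `p` in the Jacobson radical. The hypothesis `f ≠ 0` supplies at least one factor `p`. -/
theorem derivation_eq_zero_of_frobIter (d : Derivation ℤ C M)
    (hp : (p : C) ∈ (⊥ : Ideal C).jacobson)
    {A : ℕ → Matrix (Fin n) (Fin n) C} (hA : ∀ i j k, d (A i j k) = 0)
    {u : Matrix (Fin n) (Fin n) C} {μ : C} {f : ℕ} (hf : f ≠ 0) (hu : u = μ • frobIter p A u f)
    (hμ : d μ = 0 ∨ IsUnit (n : C) ∧ μ ^ n * (frobIter p A u f).det = 1) :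
    (∀ j k, d (u j k) = 0) ∧ d μ = 0 := by
  obtain ⟨f, rfl⟩ := Nat.exists_eq_succ_of_ne_zero hf
  set N : Submodule C M := Submodule.span C
    (insert (d μ) (Set.range fun jk : Fin n × Fin n => d (u jk.1 jk.2))) with hN
  have huN : ∀ j k, d (u j k) ∈ N := fun j k =>
    Submodule.subset_span (Set.mem_insert_of_mem _ ⟨(j, k), rfl⟩)
  have hv := derivation_frobIter_mem (p := p) d N hA huN f
  set v := frobIter p A u (f + 1)
  have hμN : d μ ∈ Ideal.span {(p : C)} • N := by
    rcases hμ with h | ⟨hn, h⟩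
    · rw [h]; exact Submodule.zero_mem _
    · have hdet := derivation_det_mem d _ hv
      have h1 := congrArg d h
      rw [d.leibniz, d.leibniz_pow, d.map_one_eq_zero, ← Nat.cast_smul_eq_nsmul C, smul_smul,
        smul_smul] at h1
      rcases Nat.eq_zero_or_pos n with rfl | hnpos
      · have : Subsingleton C := by
          rw [Nat.cast_zero, isUnit_zero_iff] at hn
          exact subsingleton_of_zero_eq_one hn
        rw [Subsingleton.elim μ 0, map_zero]
        exact Submodule.zero_mem _
      · obtain ⟨e, he⟩ := hn.exists_left_inv
        -- Differentiating `μ^n det v = 1` and multiplying by `eμ`, where `en = 1`, makes the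
        -- coefficient of `dμ` equal to `1`.
        have h2 : d μ = -((e * μ * μ ^ n) • d v.det) := by
          have hpow : μ ^ (n - 1) * μ = μ ^ n := pow_sub_one_mul hnpos.ne' μ
          have h3 := congrArg (fun x => (e * μ) • x) h1
          simp only [smul_add, smul_smul, smul_zero] at h3
          have h4 : e * μ * (v.det * n * μ ^ (n - 1)) = 1 := by
            linear_combination e * n * v.det * hpow + e * n * h + he
          rw [h4, one_smul] at h3
          exact eq_neg_of_add_eq_zero_right h3
        rw [h2]
        exact Submodule.neg_mem _ (Submodule.smul_mem _ _ hdet)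
  have hle : N ≤ Ideal.span {(p : C)} • N := by
    conv_lhs => rw [hN]
    rw [Submodule.span_le]
    rintro _ (rfl | ⟨⟨j, k⟩, rfl⟩)
    · exact hμN
    · change d (u j k) ∈ _
      rw [hu]
      change d (μ * v j k) ∈ _
      rw [d.leibniz]
      exact Submodule.add_mem _ (Submodule.smul_mem _ _ (hv _ _)) (Submodule.smul_mem _ _ hμN)
  have hfg : N.FG := Submodule.fg_span ((Set.finite_range _).insert _)
  have hbot := Submodule.eq_bot_of_le_smul_of_le_jacobson_bot _ N hfg hle
    ((Ideal.span_singleton_le_iff_mem _).2 hp)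
  refine ⟨fun j k => ?_, ?_⟩
  · have := huN j k
    rwa [hbot, Submodule.mem_bot] at this
  · have : d μ ∈ N := Submodule.subset_span (Set.mem_insert _ _)
    rwa [hbot, Submodule.mem_bot] at this

/-- Differentials vanishing on generators vanish everywhere, so the extension is formally
unramified; being essentially of finite type, it is finite. -/
theorem finiteDimensional_adjoin_of_differential_eq_zero {F K : Type} [Field F] [Field K]
    [Algebra F K] {S : Set K} (hS : S.Finite)
    (h : ∀ s (hs : s ∈ S), KaehlerDifferential.D F (IntermediateField.adjoin F S)
      ⟨s, IntermediateField.subset_adjoin F S hs⟩ = 0) :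
    FiniteDimensional F (IntermediateField.adjoin F S) := by
  set D := KaehlerDifferential.D F (IntermediateField.adjoin F S)
  have hD : ∀ x (hx : x ∈ IntermediateField.adjoin F S), D ⟨x, hx⟩ = 0 := by
    intro x hx
    induction hx using IntermediateField.adjoin_induction with
    | mem x hx => exact h x hx
    | algebraMap x => exact D.map_algebraMap x
    | add x y hx hy h1 h2 =>
      exact (D.map_add ⟨x, hx⟩ ⟨y, hy⟩).trans (by rw [h1, h2, add_zero])
    | inv x hx h1 =>
      exact (D.leibniz_inv ⟨x, hx⟩).trans (by rw [h1, smul_zero])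
    | mul x y hx hy h1 h2 =>
      exact (D.leibniz ⟨x, hx⟩ ⟨y, hy⟩).trans (by rw [h1, h2, smul_zero, smul_zero, add_zero])
  have hess : Algebra.EssFiniteType F (IntermediateField.adjoin F S) := by
    rw [IntermediateField.essFiniteType_iff]
    exact ⟨hS.toFinset, by rw [hS.coe_toFinset]⟩
  have hunr : Algebra.FormallyUnramified F (IntermediateField.adjoin F S) := by
    refine ⟨?_⟩
    have hspan := KaehlerDifferential.span_range_derivation F (IntermediateField.adjoin F S)
    have hrange : Set.range D ⊆ {0} := by
      rintro _ ⟨x, rfl⟩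
      exact hD x.1 x.2
    refine (Submodule.subsingleton_iff (IntermediateField.adjoin F S)).1 (subsingleton_of_bot_eq_top ?_)
    rw [← hspan, eq_comm, eq_bot_iff, ← Submodule.span_zero_singleton (IntermediateField.adjoin F S)]
    exact Submodule.span_mono hrange
  exact Algebra.FormallyUnramified.finite_of_free F _

end Derivations

end

/-! ### Fraction fields of valuation subrings -/

section FractionField

variable {p : ℕ} [Fact p.Prime]

theorem exists_pow_mul_eq_algebraMap (x : FractionRing (R p)) :
    ∃ (m : ℕ) (a : R p), x * algebraMap (R p) _ ((p : R p) ^ m) = algebraMap (R p) _ a := by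
  obtain ⟨a, b, hb, rfl⟩ := IsFractionRing.div_surjective (A := R p) x
  have hb0 : b ≠ 0 := nonZeroDivisors.ne_zero hb
  obtain ⟨m, v, rfl⟩ := WittVector.exists_eq_pow_p_mul' b hb0
  refine ⟨m, a * ↑v⁻¹, ?_⟩
  have hne : algebraMap (R p) (FractionRing (R p)) ((p : R p) ^ m * ↑v) ≠ 0 := by
    exact (map_ne_zero_iff _ (IsFractionRing.injective _ _)).2 hb0
  rw [div_mul_eq_mul_div, div_eq_iff hne, ← map_mul, ← map_mul]
  congr 1
  have hv : (↑v⁻¹ : R p) * ↑v = 1 := v.inv_mul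
  linear_combination -(a * (p : R p) ^ m) * hv

/-- Every element of the fraction field of `R` has a power of `p` as denominator, and these powers
lie in `𝒪`; hence no element of `L` is missed. -/
theorem exists_fractionRing_equiv {L : Type} [Field L] (ι : L →+* FractionRing (R p))
    {O : Subring (R p)} (hO : ∀ a, a ∈ O ↔ algebraMap (R p) (FractionRing (R p)) a ∈ ι.range) :
    ∃ e : FractionRing O ≃+* L,
      ∀ a : O, ι (e (algebraMap O _ a)) = algebraMap (R p) (FractionRing (R p)) a := by
  have hinj : Function.Injective (algebraMap (R p) (FractionRing (R p))) :=
    IsFractionRing.injective _ _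
  have hlift : ∃ g : O →+* L, ∀ a : O, ι (g a) = algebraMap (R p) (FractionRing (R p)) a := by
    let e := RingEquiv.ofLeftInverse (Function.leftInverse_invFun ι.injective)
    refine ⟨e.symm.toRingHom.comp (((algebraMap (R p) (FractionRing (R p))).comp O.subtype).codRestrict
      ι.range fun a => (hO a).1 a.2), fun a => ?_⟩
    exact congrArg Subtype.val (e.apply_symm_apply _)
  obtain ⟨g, hg⟩ := hlift
  have hginj : Function.Injective g := fun a b hab => Subtype.ext (hinj (by rw [← hg, ← hg, hab]))
  have hsurj : Function.Surjective (IsFractionRing.lift (K := FractionRing O) hginj) := by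
    intro x
    obtain ⟨m, a, ha⟩ := exists_pow_mul_eq_algebraMap (ι x)
    have haO : a ∈ O := by
      rw [hO, ← ha, map_pow, map_natCast, ← map_natCast ι, ← map_pow, ← map_mul]
      exact ⟨_, rfl⟩
    have hpm : ((p : O) ^ m) ≠ 0 := by
      intro h
      have := congrArg O.subtype h
      rw [map_pow, map_natCast, map_zero] at this
      exact pow_ne_zero m natCast_p_ne_zero this
    refine ⟨algebraMap O _ ⟨a, haO⟩ / algebraMap O _ ((p : O) ^ m), ?_⟩
    have hgpm : g ((p : O) ^ m) ≠ 0 := (map_ne_zero_iff g hginj).2 hpm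
    rw [map_div₀, IsFractionRing.lift_algebraMap, IsFractionRing.lift_algebraMap,
      div_eq_iff hgpm]
    apply ι.injective
    rw [hg, map_mul, hg]
    exact ha.symm
  have hbij : Function.Bijective (IsFractionRing.lift (K := FractionRing O) hginj) :=
    ⟨RingHom.injective _, hsurj⟩
  exact ⟨RingEquiv.ofBijective _ hbij, fun a =>
    (congrArg ι (IsFractionRing.lift_algebraMap hginj a)).trans (hg a)⟩

theorem isGenericallyFinite_of_finiteDimensional {F : Subfield (FractionRing (R p))}
    {L : IntermediateField F (FractionRing (R p))} [FiniteDimensional F L] {O O' : Subring (R p)}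
    (hO : ∀ a, a ∈ O ↔ algebraMap (R p) (FractionRing (R p)) a ∈ F)
    (hO' : ∀ a, a ∈ O' ↔ algebraMap (R p) (FractionRing (R p)) a ∈ L) (h : O ≤ O') :
    IsGenericallyFinite p h := by
  obtain ⟨e, he⟩ := exists_fractionRing_equiv (algebraMap F (FractionRing (R p))) (O := O) (by
    intro a
    rw [hO]
    exact ⟨fun h => ⟨⟨_, h⟩, rfl⟩, by rintro ⟨x, hx⟩; rw [← hx]; exact x.2⟩)
  obtain ⟨e', he'⟩ := exists_fractionRing_equiv (algebraMap L (FractionRing (R p))) (O := O') (by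
    intro a
    rw [hO']
    exact ⟨fun h => ⟨⟨_, h⟩, rfl⟩, by rintro ⟨x, hx⟩; rw [← hx]; exact x.2⟩)
  have key : IsFractionRing.map (K := FractionRing O) (L := FractionRing O')
      (Subring.inclusion_injective h) =
      (e'.symm : L →+* FractionRing O').comp ((algebraMap F L).comp (e : FractionRing O →+* F)) := by
    refine IsLocalization.ringHom_ext (nonZeroDivisors O) (RingHom.ext fun a => ?_)
    simp only [RingHom.comp_apply, RingEquiv.coe_toRingHom]
    rw [RingEquiv.eq_symm_apply]
    apply (algebraMap L (FractionRing (R p))).injective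
    rw [← IsScalarTower.algebraMap_apply F L, he]
    have : IsFractionRing.map (K := FractionRing O) (L := FractionRing O')
      (Subring.inclusion_injective h) (algebraMap O _ a) =
        algebraMap O' _ (Subring.inclusion h a) := IsLocalization.map_eq _ _
    rw [this, he']
    rfl
  rw [IsGenericallyFinite, key]
  exact (RingHom.Finite.of_surjective _ e'.symm.surjective).comp
    ((RingHom.finite_algebraMap.2 inferInstance).comp (RingHom.Finite.of_surjective _ e.surjective))

end FractionField

/-! ### Algebraicity of solutions -/

section Algebraicity

variable {p : ℕ} [Fact p.Prime]

/-- The derivation is only `ℤ`-linear because `F` does not act on `C`. The module structure is part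
of the conclusion so that it can be introduced locally. -/
theorem exists_derivation_comp {F L C : Type} [CommRing F] [CommRing L] [CommRing C] [Algebra F L]
    {M : Type} [AddCommGroup M] {_ : Module L M} {_ : Module F M} (D : Derivation F L M) (ι : C →+* L) :
    ∃ (_ : Module C M) (d : Derivation ℤ C M), ∀ c, d c = D (ι c) := by
  let _ : Module C M := Module.compHom M ι
  refine ⟨inferInstance, Derivation.mk' ((D.toLinearMap.toAddMonoidHom.comp
    ι.toAddMonoidHom).toIntLinearMap) fun a b => ?_, fun c => rfl⟩
  change D (ι (a * b)) = ι a • D (ι b) + ι b • D (ι a)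
  rw [map_mul, D.leibniz]

theorem isUnit_of_mem_comap (L : Subfield (FractionRing (R p))) {a : R p}
    (ha : a ∈ L.toSubring.comap (algebraMap (R p) (FractionRing (R p)))) (hu : IsUnit a) :
    IsUnit (⟨a, ha⟩ : L.toSubring.comap (algebraMap (R p) (FractionRing (R p)))) := by
  obtain ⟨b, hb⟩ := isUnit_iff_exists_inv.1 hu
  have hbL : algebraMap (R p) (FractionRing (R p)) b ∈ L := by
    have h := congrArg (algebraMap (R p) (FractionRing (R p))) hb
    rw [map_mul, map_one] at h
    rw [← inv_eq_of_mul_eq_one_right h]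
    exact L.inv_mem ha
  exact isUnit_iff_exists_inv.2 ⟨⟨b, hbL⟩, Subtype.ext hb⟩

theorem natCast_mem_jacobson_comap (L : Subfield (FractionRing (R p))) :
    (p : L.toSubring.comap (algebraMap (R p) (FractionRing (R p)))) ∈
      (⊥ : Ideal (L.toSubring.comap (algebraMap (R p) (FractionRing (R p))))).jacobson := by
  rw [Ideal.mem_jacobson_bot]
  intro y
  refine isUnit_of_mem_comap L (p * y + 1).2 (isUnit_of_dvd_sub isUnit_one ⟨y, ?_⟩)
  change (p : R p) * y + 1 - 1 = p * y
  rw [add_sub_cancel_right]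

theorem isUnit_natCast_of_not_dvd {n : ℕ} (hn : ¬ p ∣ n) : IsUnit (n : R p) := by
  refine isUnit_of_not_dvd fun h => ?_
  obtain ⟨a, b, hab⟩ := (Nat.isCoprime_iff_coprime.2
    ((Nat.Prime.coprime_iff_not_dvd Fact.out).2 hn)).map (Int.castRingHom (R p))
  refine not_isUnit_natCast_p (isUnit_of_dvd_one (a := (p : R p)) ?_)
  rw [← hab]
  simpa using dvd_add (dvd_mul_left _ _) (h.mul_left _)

theorem isIntegral_of_frobIter {n : ℕ} {F : Subfield (FractionRing (R p))}
    {A : ℕ → Matrix (Fin n) (Fin n) (R p)}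
    (hA : ∀ i j k, algebraMap (R p) (FractionRing (R p)) (A i j k) ∈ F)
    {u : Matrix (Fin n) (Fin n) (R p)} {μ : R p} {f : ℕ} (hf : f ≠ 0)
    (hu : u = μ • frobIter p A u f)
    (hμ : μ = 1 ∨ ¬ p ∣ n ∧ μ ^ n * (frobIter p A u f).det = 1) (j k : Fin n) :
    IsIntegral F (algebraMap (R p) (FractionRing (R p)) (u j k)) := by
  set S : Set (FractionRing (R p)) := insert (algebraMap (R p) (FractionRing (R p)) μ)
    (Set.range fun jk : Fin n × Fin n => algebraMap (R p) (FractionRing (R p)) (u jk.1 jk.2))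
    with hS
  have hSfin : S.Finite := (Set.finite_range _).insert _
  set L := IntermediateField.adjoin F S
  have hSL : ∀ s ∈ S, s ∈ L := IntermediateField.subset_adjoin F S
  -- Nakayama must be run over `R ∩ L`, where `p` is in the Jacobson radical, and not over `L`,
  -- where `p` is invertible.
  set C := L.toSubfield.toSubring.comap (algebraMap (R p) (FractionRing (R p))) with hC
  have hμC : μ ∈ C := hSL _ (Set.mem_insert _ _)
  have huC : ∀ j k, u j k ∈ C := fun j k => hSL _ (Set.mem_insert_of_mem _ ⟨(j, k), rfl⟩)
  have hAC : ∀ i j k, A i j k ∈ C := fun i j k => L.algebraMap_mem ⟨_, hA i j k⟩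
  let ι : C →+* L := ((algebraMap (R p) (FractionRing (R p))).comp C.subtype).codRestrict L
    fun c => c.2
  obtain ⟨_, d, hd⟩ := exists_derivation_comp (KaehlerDifferential.D F L) ι
  let μ' : C := ⟨μ, hμC⟩
  let u' : Matrix (Fin n) (Fin n) C := Matrix.of fun j k => ⟨u j k, huC j k⟩
  let A' : ℕ → Matrix (Fin n) (Fin n) C := fun i => Matrix.of fun j k => ⟨A i j k, hAC i j k⟩
  have hiter : (frobIter p A' u' f).map C.subtype = frobIter p A u f := frobIter_map _ _ _ _ _
  have hdA : ∀ i j k, d (A' i j k) = 0 := fun i j k =>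
    (hd _).trans ((KaehlerDifferential.D F L).map_algebraMap ⟨_, hA i j k⟩)
  have hinj : Function.Injective C.subtype := Subtype.val_injective
  have hu' : u' = μ' • frobIter p A' u' f := by
    refine Matrix.ext fun j k => hinj ?_
    have h := congrFun (congrFun hu j) k
    rw [← hiter] at h
    exact h
  have hμ' : d μ' = 0 ∨ IsUnit (n : C) ∧ μ' ^ n * (frobIter p A' u' f).det = 1 := by
    rcases hμ with h | ⟨hn, h⟩
    · left
      have : μ' = 1 := Subtype.ext h
      rw [this, d.map_one_eq_zero]
    · right
      refine ⟨isUnit_of_mem_comap L.toSubfield (n : C).2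
        (isUnit_natCast_of_not_dvd hn), hinj ?_⟩
      rw [map_mul, map_pow, RingHom.map_det, RingHom.mapMatrix_apply, hiter, map_one]
      exact h
  obtain ⟨h1, h2⟩ := derivation_eq_zero_of_frobIter d (natCast_mem_jacobson_comap L.toSubfield)
    hdA hf hu' hμ'
  have hfin := finiteDimensional_adjoin_of_differential_eq_zero (F := F) hSfin (by
    rintro s (rfl | ⟨⟨j, k⟩, rfl⟩)
    · exact (hd μ').symm.trans h2
    · exact (hd (u' j k)).symm.trans (h1 j k))
  have hint : IsIntegral F (⟨_, huC j k⟩ : L) :=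
    (Algebra.IsIntegral.of_finite F L).isIntegral _
  exact hint.map (L.val)

end Algebraicity

/-! ### Finite `φ`-stable extensions -/

section FiniteExtension

variable {p : ℕ} [Fact p.Prime]

/-- The extension of `φ` to the field of fractions of `R`. -/
noncomputable def phiFrac (p : ℕ) [Fact p.Prime] : FractionRing (R p) →+* FractionRing (R p) :=
  IsFractionRing.map (j := phi p) phi_bijective.1

theorem phiFrac_algebraMap (a : R p) :
    phiFrac p (algebraMap (R p) _ a) = algebraMap (R p) _ (phi p a) :=
  IsLocalization.map_eq
    (nonZeroDivisors_le_comap_nonZeroDivisors_of_injective (phi p) phi_bijective.1) a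

theorem IsDeltaSubring.phi_mem {O : Subring (R p)} (hO : IsDeltaSubring p O) {a : R p}
    (ha : a ∈ O) : phi p a ∈ O := by
  rw [(delta_eq_iff (a := a)).1 rfl]
  exact add_mem (pow_mem ha _) (mul_mem (natCast_mem _ _) (hO a ha))

theorem phiFrac_mem {O : Subring (R p)} (hδ : IsDeltaSubring p O)
    {F : Subfield (FractionRing (R p))}
    (hO : ∀ a, a ∈ O ↔ algebraMap (R p) (FractionRing (R p)) a ∈ F) {x : FractionRing (R p)}
    (hx : x ∈ F) : phiFrac p x ∈ F := by
  obtain ⟨m, a, ha⟩ := exists_pow_mul_eq_algebraMap x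
  have hpm : algebraMap (R p) (FractionRing (R p)) ((p : R p) ^ m) ≠ 0 := by
    exact (map_ne_zero_iff _ (IsFractionRing.injective _ _)).2 (pow_ne_zero m natCast_p_ne_zero)
  have hpF : algebraMap (R p) (FractionRing (R p)) ((p : R p) ^ m) ∈ F :=
    (hO _).1 (pow_mem (natCast_mem _ _) _)
  have haO : a ∈ O := by
    rw [hO, ← ha]
    exact F.mul_mem hx hpF
  rw [← eq_div_iff hpm] at ha
  rw [ha, map_div₀, phiFrac_algebraMap, phiFrac_algebraMap, map_pow (phi p), map_natCast]
  exact F.div_mem ((hO _).1 (hδ.phi_mem haO)) hpF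

/-- Adjoining a finite `φ`-stable set of algebraic elements to `F` gives a finite `φ`-stable field
`L`. Then `R ∩ L` is stable under `δ`, since dividing by `p` is allowed in `L`. -/
theorem exists_deltaSubring_of_isIntegral {O : Subring (R p)} (hδ : IsDeltaSubring p O)
    {F : Subfield (FractionRing (R p))}
    (hO : ∀ a, a ∈ O ↔ algebraMap (R p) (FractionRing (R p)) a ∈ F) {S : Set (R p)}
    (hS : S.Finite) (hint : ∀ s ∈ S, IsIntegral F (algebraMap (R p) (FractionRing (R p)) s))
    (hphi : ∀ s ∈ S, phi p s ∈ S) :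
    ∃ (O' : Subring (R p)) (h : O ≤ O'), IsDeltaSubring p O' ∧ IsGenericallyFinite p h ∧
      S ⊆ O' := by
  set T := algebraMap (R p) (FractionRing (R p)) '' S
  set L := IntermediateField.adjoin F T
  have : Finite T := hS.image _
  have hfin : FiniteDimensional F L := IntermediateField.finiteDimensional_adjoin (by
    rintro _ ⟨s, hs, rfl⟩
    exact hint s hs)
  have hphiL : ∀ x ∈ L, phiFrac p x ∈ L := by
    intro x hx
    induction hx using IntermediateField.adjoin_induction with
    | mem x hx =>
      obtain ⟨s, hs, rfl⟩ := hx
      rw [phiFrac_algebraMap]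
      exact IntermediateField.subset_adjoin F T ⟨_, hphi s hs, rfl⟩
    | algebraMap x => exact L.algebraMap_mem ⟨_, phiFrac_mem hδ hO x.2⟩
    | add x y _ _ h1 h2 => rw [map_add]; exact add_mem h1 h2
    | inv x _ h => rw [map_inv₀]; exact inv_mem h
    | mul x y _ _ h1 h2 => rw [map_mul]; exact mul_mem h1 h2
  have hle : O ≤ L.toSubfield.toSubring.comap (algebraMap (R p) (FractionRing (R p))) :=
    fun a ha => L.algebraMap_mem ⟨_, (hO a).1 ha⟩
  refine ⟨L.toSubfield.toSubring.comap (algebraMap (R p) (FractionRing (R p))), hle,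
    fun a (ha : algebraMap (R p) (FractionRing (R p)) a ∈ L) => ?_, isGenericallyFinite_of_finiteDimensional (L := L) hO (fun _ => Iff.rfl) hle,
    fun s hs => IntermediateField.subset_adjoin F T ⟨s, hs, rfl⟩⟩
  have hp0 : algebraMap (R p) (FractionRing (R p)) p ≠ 0 := by
    exact (map_ne_zero_iff _ (IsFractionRing.injective _ _)).2 natCast_p_ne_zero
  have h1 : algebraMap (R p) (FractionRing (R p)) (delta p a) =
      (algebraMap (R p) (FractionRing (R p)) (phi p a) -
        algebraMap (R p) (FractionRing (R p)) a ^ p) / algebraMap (R p) (FractionRing (R p)) p := by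
    rw [eq_div_iff hp0, ← map_pow, ← map_sub, ← mul_delta, map_mul, mul_comm]
  change algebraMap (R p) (FractionRing (R p)) (delta p a) ∈ L
  rw [h1, ← phiFrac_algebraMap, map_natCast]
  exact div_mem (sub_mem (hphiL _ ha) (pow_mem ha _)) (natCast_mem L p)

theorem isIntegral_phi_pow {O : Subring (R p)} (hδ : IsDeltaSubring p O)
    {F : Subfield (FractionRing (R p))}
    (hO : ∀ a, a ∈ O ↔ algebraMap (R p) (FractionRing (R p)) a ∈ F) {a : R p}
    (ha : IsIntegral F (algebraMap (R p) (FractionRing (R p)) a)) (i : ℕ) :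
    IsIntegral F (algebraMap (R p) (FractionRing (R p)) ((phi p ^ i) a)) := by
  induction i with
  | zero => exact ha
  | succ i ih =>
    rw [pow_succ', RingHom.mul_def, RingHom.comp_apply, ← phiFrac_algebraMap]
    exact ih.map_of_comp_eq ((phiFrac p).restrict F F fun x hx => phiFrac_mem hδ hO hx)
      (phiFrac p) (RingHom.ext fun x => rfl)

end FiniteExtension

/-! ### Solutions over a finite residue field -/

section FiniteResidueField

variable {p : ℕ} [Fact p.Prime] {n : ℕ}

theorem exists_coeff_zero_pow_eq {O : Subring (R p)} (hO : IsValuationSubring p O)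
    (hfin : HasFiniteResidueField p O) :
    ∃ f : ℕ, f ≠ 0 ∧ ∀ a ∈ O, a.coeff 0 ^ p ^ f = a.coeff 0 := by
  obtain ⟨hloc, hfin⟩ := hfin
  -- An element of `𝒪` that is a unit in `R` has its inverse in `𝒪`. Hence relations in the residue
  -- field of `𝒪` hold for residues in `k`.
  have hdvd : ∀ x : O, x ∈ IsLocalRing.maximalIdeal O → (p : R p) ∣ x := by
    intro x hx
    by_contra h
    obtain ⟨b, hb⟩ := isUnit_iff_exists_inv.1 (isUnit_of_not_dvd h)
    have hbO : b ∈ O := hO.mem_of_mul_mem x.2 (left_ne_zero_of_mul_eq_one hb) (by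
      rw [hb]; exact one_mem O)
    exact (IsLocalRing.mem_maximalIdeal x).1 hx
      (isUnit_iff_exists_inv.2 ⟨⟨b, hbO⟩, Subtype.ext hb⟩)
  have hp : (p : IsLocalRing.ResidueField O) = 0 := by
    rw [← map_natCast (IsLocalRing.residue O), IsLocalRing.residue_eq_zero_iff,
      IsLocalRing.mem_maximalIdeal]
    intro h
    have := h.map O.subtype
    rw [map_natCast] at this
    exact not_isUnit_natCast_p this
  have := Fintype.ofFinite (IsLocalRing.ResidueField O)
  have : CharP (IsLocalRing.ResidueField O) p :=
    ringChar.of_eq (CharP.ringChar_of_prime_eq_zero Fact.out hp)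
  obtain ⟨f, -, hcard⟩ := FiniteField.card (IsLocalRing.ResidueField O) p
  refine ⟨f, f.ne_zero, fun a ha => ?_⟩
  have h1 := FiniteField.pow_card (IsLocalRing.residue O ⟨a, ha⟩)
  rw [hcard, ← map_pow, ← sub_eq_zero, ← map_sub, IsLocalRing.residue_eq_zero_iff] at h1
  have h2 := dvd_iff_coeff_zero.1 (hdvd _ h1)
  rw [← sub_eq_zero]
  have h3 : WittVector.constantCoeff (a ^ p ^ (f : ℕ) - a) = 0 := h2
  rwa [map_sub, map_pow] at h3

end FiniteResidueField

section FiniteResidueFieldSolutions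

variable {p : ℕ} [Fact p.Prime] {n : ℕ}

/-- For these two types `Φ` is built from `x` with coefficients coming from `ℤ_p`, which `φ` fixes.
This is where the type of `Δ` is needed for periodicity. -/
theorem Phi_evalHat_map_phi_pow {Δ : Matrix (Fin n) (Fin n) (CoordHat p n (R p))}
    (h : IsTypeGL p Δ ∨ IsTypeSL p Δ) (f : ℕ) (u : GL (Fin n) (R p)) :
    (Phi p Δ).map (evalHat p (Matrix.GeneralLinearGroup.map (phi p ^ f) u)) =
      ((Phi p Δ).map (evalHat p u)).map (phi p ^ f) := by
  set v := Matrix.GeneralLinearGroup.map (phi p ^ f) u with hv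
  have hvu : v.val = u.val.map (phi p ^ f) := rfl
  rcases h with h | h
  · have hΔ : Δ = 0 := h
    rw [Phi, hΔ, smul_zero, add_zero, frobPow_map, frobPow_map, frobPow_map, X_map_evalHat,
      X_map_evalHat, hvu]
  · obtain ⟨z, w, hz, hw, -, hPhi⟩ := h.exists_scalar u
    obtain ⟨z', w', hz', hw', -, hPhi'⟩ := h.exists_scalar v
    have hzz : (phi p ^ f) z = z' := by
      have hdet : IsUnit (v.val.det ^ p) := ((Matrix.isUnit_iff_isUnit_det _).1 v.isUnit).pow p
      refine hdet.mul_right_cancel ?_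
      rw [hz', hvu, ← frobPow_map, ← RingHom.mapMatrix_apply, ← RingHom.mapMatrix_apply,
        ← RingHom.map_det, ← RingHom.map_det, ← hz, map_mul, map_pow]
    have hww : (phi p ^ f) w = w' := by
      have h1 := hw.phi_pow f
      rw [hzz] at h1
      exact HasPadicSum.unique h1 hw'
    rw [hPhi, hPhi', hvu, ← hww, ← frobPow_map]
    refine Matrix.ext fun i j => ?_
    simp only [Matrix.map_apply, Matrix.smul_apply, smul_eq_mul, map_mul]

theorem exists_map_phi_pow_eq_smul_frobIter {B u : Matrix (Fin n) (Fin n) (R p)} {w : R p}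
    (h : u.map (phi p) = w • (B * frobPow p u)) (i : ℕ) :
    ∃ μ : R p, (w = 1 → μ = 1) ∧
      u.map (phi p ^ i) = μ • frobIter p (fun i => B.map (phi p ^ i)) u i := by
  induction i with
  | zero => exact ⟨1, fun _ => rfl, by rw [one_smul]; rfl⟩
  | succ i ih =>
    obtain ⟨μ, hμ1, hμ⟩ := ih
    -- Applying `φ^i` to the equation contributes `φ^i(w)`, and the earlier scalar leaves the
    -- entrywise power as `μ^p`.
    refine ⟨(phi p ^ i) w * μ ^ p, fun hw => by rw [hw, hμ1 hw, map_one, one_pow, one_mul], ?_⟩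
    have h1 : u.map (phi p ^ (i + 1)) = (u.map (phi p)).map (phi p ^ i) := by
      rw [pow_succ]; rfl
    have h2 : (w • (B * frobPow p u)).map (phi p ^ i) =
        (phi p ^ i) w • (B * frobPow p u).map (phi p ^ i) :=
      Matrix.ext fun j k => map_mul (phi p ^ i) w ((B * frobPow p u) j k)
    have h3 : ∀ M : Matrix (Fin n) (Fin n) (R p), frobPow p (μ • M) = μ ^ p • frobPow p M :=
      fun M => Matrix.ext fun j k => mul_pow _ _ _
    rw [h1, h, h2, Matrix.map_mul, frobPow_map, hμ, h3, Matrix.mul_smul, smul_smul]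
    rfl

theorem exists_deltaSubring_entriesIn {O : Subring (R p)} (hO : IsValuationSubring p O)
    (hδ : IsDeltaSubring p O) (hfin : HasFiniteResidueField p O)
    {Δ : Matrix (Fin n) (Fin n) (CoordHat p n (R p))} {α : Matrix (Fin n) (Fin n) (R p)}
    {u u₀ : GL (Fin n) (R p)} (hu : IsSolution p Δ α u) (huu₀ : MatCongr (p : R p) u.val u₀.val)
    (hu₀ : EntriesIn p O u₀.val) (hα : EntriesIn p O α)
    (hΔ : IsTypeGL p Δ ∨ IsTypeSL p Δ ∧ u.val ∈ SLn) :
    ∃ (O' : Subring (R p)) (h : O ≤ O'), IsDeltaSubring p O' ∧ IsGenericallyFinite p h ∧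
      EntriesIn p O' u.val := by
  obtain ⟨f, hf, hres⟩ := exists_coeff_zero_pow_eq hO hfin
  have hfix : ∀ a ∈ O, (phi p ^ f) a = a := fun a ha => hO.phi_pow_eq_self hf hres ha
  set B : Matrix (Fin n) (Fin n) (R p) := 1 + p • α with hB
  have hBO : ∀ i j, B i j ∈ O := by
    intro i j
    rw [hB, Matrix.add_apply, Matrix.smul_apply, Matrix.one_apply]
    refine add_mem ?_ (nsmul_mem (hα _ _) _)
    split_ifs
    exacts [one_mem O, zero_mem O]
  have hu' := isSolution_iff.1 hu
  -- `φ^f` fixes `α` and `u₀`, so `φ^f(u)` is a solution in the same residue class and uniqueness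
  -- applies.
  have hper : Matrix.GeneralLinearGroup.map (phi p ^ f) u = u := by
    refine eq_of_isSolution (isSolution_iff.2 ?_) hu ?_
    · rw [Phi_evalHat_map_phi_pow (hΔ.imp_right And.left)]
      have h1 : (u.val.map (phi p ^ f)).map (phi p) = (u.val.map (phi p)).map (phi p ^ f) := by
        have h2 : (phi p).comp (phi p ^ f) = (phi p ^ f).comp (phi p) :=
          (pow_succ' (phi p) f).symm.trans (pow_succ (phi p) f)
        exact Matrix.ext fun i j => congrArg (fun g => g (u.val i j)) h2
      change (u.val.map (phi p ^ f)).map (phi p) = _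
      rw [h1, hu', Matrix.map_mul]
      congr 1
      exact Matrix.ext fun i j => hfix _ (hBO i j)
    · have h1 := huu₀.map (phi p ^ f)
      rw [map_natCast] at h1
      have h2 : u₀.val.map (phi p ^ f) = u₀.val := Matrix.ext fun i j => hfix _ (hu₀ i j)
      rw [h2] at h1
      exact h1.trans huu₀.symm
  have hper' : u.val.map (phi p ^ f) = u.val := congrArg Units.val hper
  obtain ⟨w, hw, hw1⟩ : ∃ w : R p, u.val.map (phi p) = w • (B * frobPow p u.val) ∧
      (w = 1 ∨ ¬ p ∣ n ∧ u.val.det = 1) := by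
    rcases hΔ with h | ⟨h, hdet⟩
    · refine ⟨1, ?_, Or.inl rfl⟩
      have hΔ0 : Δ = 0 := h
      rw [hu', hΔ0, Phi, smul_zero, add_zero, frobPow_map, X_map_evalHat, one_smul]
    · obtain ⟨z, w, -, -, -, hPhi⟩ := h.exists_scalar u
      exact ⟨w, by rw [hu', hPhi, Matrix.mul_smul], Or.inr ⟨h.1, hdet⟩⟩
  obtain ⟨μ, hμ1, hμ⟩ := exists_map_phi_pow_eq_smul_frobIter hw f
  rw [hper'] at hμ
  obtain ⟨F, hF⟩ := hO
  have hphiO : ∀ (i : ℕ), ∀ a ∈ O, (phi p ^ i) a ∈ O := by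
    intro i a ha
    induction i with
    | zero => exact ha
    | succ i ih => rw [pow_succ', RingHom.mul_def]; exact hδ.phi_mem ih
  have hint : ∀ j k, IsIntegral F (algebraMap (R p) (FractionRing (R p)) (u.val j k)) := by
    refine isIntegral_of_frobIter (fun i j k => (hF _).1 (hphiO i _ (hBO j k))) hf hμ ?_
    rcases hw1 with h | ⟨hn, hdet⟩
    · exact Or.inl (hμ1 h)
    -- The scalar `μ` is treated as an extra unknown, and taking determinants with `det u = 1`
    -- supplies its equation.
    · refine Or.inr ⟨hn, ?_⟩
      have := congrArg Matrix.det hμ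
      rw [hdet, Matrix.det_smul, Fintype.card_fin] at this
      exact this.symm
  obtain ⟨O', hle, hδ', hgen, hS⟩ := exists_deltaSubring_of_isIntegral hδ hF
    (S := Set.range fun x : Fin f × Fin n × Fin n => (phi p ^ (x.1 : ℕ)) (u.val x.2.1 x.2.2))
    (Set.finite_range _) (by
      rintro _ ⟨⟨i, j, k⟩, rfl⟩
      exact isIntegral_phi_pow hδ hF (hint j k) i) (by
      rintro _ ⟨⟨i, j, k⟩, rfl⟩
      have h1 : phi p ((phi p ^ (i : ℕ)) (u.val j k)) = (phi p ^ ((i : ℕ) + 1)) (u.val j k) := by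
        rw [pow_succ']; rfl
      change phi p ((phi p ^ (i : ℕ)) (u.val j k)) ∈ _
      rw [h1]
      -- The orbit closes up after `f` steps because `φ^f(u) = u`.
      rcases Nat.lt_or_ge ((i : ℕ) + 1) f with hi | hi
      · exact ⟨(⟨i + 1, hi⟩, j, k), rfl⟩
      · have hif : (i : ℕ) + 1 = f := le_antisymm i.2 hi
        refine ⟨(⟨0, Nat.pos_of_ne_zero hf⟩, j, k), ?_⟩
        rw [hif]
        exact (congrFun (congrFun hper' j) k).symm)
  exact ⟨O', hle, hδ', hgen, fun j k => hS ⟨(⟨0, Nat.pos_of_ne_zero hf⟩, j, k), rfl⟩⟩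

end FiniteResidueFieldSolutions

end DeltaLinear

open DeltaLinear in
theorem theorem1p1 (p : ℕ) [Fact p.Prime] (hp : p ≠ 2) (n : ℕ)
    (Δ : Matrix (Fin n) (Fin n) (CoordHat p n (R p)))
    (u₀ : Matrix.GeneralLinearGroup (Fin n) (R p)) (α : Matrix (Fin n) (Fin n) (R p)) :
    (∃! u : Matrix.GeneralLinearGroup (Fin n) (R p), IsSolution p Δ α u ∧ CongrModP p u u₀) ∧
    ∀ u : Matrix.GeneralLinearGroup (Fin n) (R p), IsSolution p Δ α u → CongrModP p u u₀ →
      (∀ O : Subring (R p), IsValuationSubring p O → IsPComplete p O →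
        DefinedOver p O Δ → EntriesIn p O u₀.val → EntriesIn p O α → EntriesIn p O u.val) ∧
      (IsTypeSL p Δ → u₀.val ∈ SLn → α ∈ deltaLie p SLn → u.val ∈ SLn) ∧
      (∀ q : Matrix (Fin n) (Fin n) (R p), IsClassicalForm q → IsTypeSO p q Δ →
        u₀.val ∈ SOq q → α ∈ deltaLie p (SOq q) → u.val ∈ SOq q) ∧
      (∀ O : Subring (R p), IsValuationSubring p O → IsDeltaSubring p O →
        HasFiniteResidueField p O → EntriesIn p O u₀.val → EntriesIn p O α →
        (IsTypeGL p Δ ∨ IsTypeSL p Δ ∧ u.val ∈ SLn) →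
        ∃ (O' : Subring (R p)) (h : O ≤ O'), IsDeltaSubring p O' ∧ IsGenericallyFinite p h ∧
          EntriesIn p O' u.val) := by
  refine ⟨?_, fun u hu huu₀ => ⟨fun O hO hc hΔ hu₀ hα => ?_, fun hΔ hu₀ hα => ?_,
    fun q hq hΔ hu₀ hα => ?_, fun O hO hδ hfin hu₀ hα hΔ => ?_⟩⟩
  · obtain ⟨u, hu, huu₀⟩ := exists_isSolution Δ α u₀
    refine ⟨u, ⟨hu, huu₀⟩, fun v hv => ?_⟩
    exact eq_of_isSolution hv.1 hu (MatCongr.trans hv.2 huu₀.symm)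
  · exact entriesIn_of_isSolution hO hc hu huu₀ hΔ hu₀ hα
  · exact det_eq_one_of_isSolution hu huu₀ hΔ hu₀ hα
  · exact mem_SOq_of_isSolution hp hq hΔ hu huu₀ hu₀ hα
  · exact exists_deltaSubring_entriesIn hO hδ hfin hu huu₀ hu₀ hα hΔ
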